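/- Let $G$ be a graph (loops and parallel edges allowed) with finite edge set $E$. The bicircular matroid $B(G)$ is the matroid on $E$ whose independent sets are the sets $I\subseteq E$ such that every connected component of the subgraph $G[I]$ formed by the edges in $I$ contains at most one cycle. A matroid is bicircular if it equals $B(G)$ for some graph $G$, and cobicircular if its dual is bicircular; an oriented matroid is called bicircular (cobicircular) if its underlying matroid is. For an oriented matroid $O$ on a finite set $E$, a flow (coflow) of $O$ is an element of the integer lattice in $\mathbb{Z}^E$ generated by the signed characteristic vectors of the signed circuits (signed cocircuits) of $O$. The oriented matroid $O$ is $GSP$ (generalized series parallel) if every simple minor of $O$ with nonempty ground set has a nonzero $\{0,1,-1\}$-valued coflow with at most two nonzero entries, and $coGSP$ if every cosimple minor of $O$ with nonempty ground set has a nonzero $\{0,1,-1\}$-valued flow with at most two nonzero entries. **Proposition.** Every oriented bicircular matroid is $coGSP$. Equivalently, every oriented cobicircular matroid is $GSP$. -/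

import Mathlib

/-! ### Matroids -/

/-- A matroid is simple if it has no loops and no parallel pairs, that is, if each of its circuits
has at least three elements. -/
def Matroid.IsSimple {β : Type*} (M : Matroid β) : Prop :=
  ∀ C, M.IsCircuit C → 3 ≤ C.encard

/-- A matroid is cosimple if its dual is simple. -/
def Matroid.IsCosimple {β : Type*} (M : Matroid β) : Prop :=
  M✶.IsSimple

/-! ### Bicircular matroids

`Graph V β` is the type of multigraphs (loops and parallel edges allowed) whose edges are labelled
by elements of `β`. -/

/-- `C` is the edge set of a cycle of `G`: there are pairwise distinct vertices `v 0, …, v n` and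
pairwise distinct edges `e 0, …, e n` such that `e i` joins `v i` to `v (i + 1)`, where the indices
are read cyclically (addition in `Fin (n + 1)` wraps around).  A loop is a cycle with one edge, two
parallel edges form a cycle with two edges. -/
def Graph.IsCycleEdgeSet {V β : Type*} (G : Graph V β) (C : Set β) : Prop :=
  ∃ (n : ℕ) (v : Fin (n + 1) → V) (e : Fin (n + 1) → β),
    Function.Injective v ∧ Function.Injective e ∧
    (∀ i, G.IsLink (e i) (v i) (v (i + 1))) ∧ C = Set.range e

/-- The vertices `x` and `y` are joined by a walk of `G` all of whose edges lie in `I`. -/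
def Graph.JoinedIn {V β : Type*} (G : Graph V β) (I : Set β) (x y : V) : Prop :=
  Relation.ReflTransGen (fun a b ↦ ∃ e ∈ I, G.IsLink e a b) x y

/-- `I` is a set of edges of `G` such that every connected component of the subgraph `G[I]` contains
at most one cycle: two cycles of `G[I]` which have vertices in the same component are equal. -/
def Graph.BicircularIndep {V β : Type*} (G : Graph V β) (I : Set β) : Prop :=
  I ⊆ G.edgeSet ∧
  ∀ C₁ C₂ : Set β, C₁ ⊆ I → C₂ ⊆ I → G.IsCycleEdgeSet C₁ → G.IsCycleEdgeSet C₂ →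
    (∃ e₁ ∈ C₁, ∃ e₂ ∈ C₂, ∃ x y, G.Inc e₁ x ∧ G.Inc e₂ y ∧ G.JoinedIn I x y) → C₁ = C₂

/-- `M` is the bicircular matroid of `G`. A matroid is determined by its ground set and its
independent sets, so there is exactly one such `M` when `G` has finitely many edges. -/
def Graph.IsBicircularMatroid {V β : Type*} (G : Graph V β) (M : Matroid β) : Prop :=
  M.E = G.edgeSet ∧ ∀ I, M.Indep I ↔ G.BicircularIndep I

/-! ### Oriented matroids -/

/-- A matroid together with a collection of sign vectors on its ground set.  It is an
oriented matroid if the signed circuit axioms hold, see `SignedMatroid.IsOriented`. The element `e`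
belongs to the positive part of `X` if `X e = 1`, to the negative part if `X e = -1`. -/
structure SignedMatroid (β : Type*) where
  /-- the underlying matroid -/
  toMatroid : Matroid β
  /-- the signed circuits -/
  circuits : Set (β → SignType)

namespace SignedMatroid

/-- The signed circuit axioms of a (finite) oriented matroid with a given underlying matroid. -/
structure IsOriented {β : Type*} (O : SignedMatroid β) : Prop where
  /-- the ground set is finite -/
  finite : O.toMatroid.E.Finite
  /-- the circuits of the underlying matroid are the supports of the signed circuits -/
  isCircuit_iff : ∀ C, O.toMatroid.IsCircuit C ↔ ∃ X ∈ O.circuits, Function.support X = C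
  /-- symmetry -/
  neg_mem : ∀ X ∈ O.circuits, -X ∈ O.circuits
  /-- incomparability (supports of signed circuits are never properly contained in each other) -/
  eq_or_eq_neg : ∀ X ∈ O.circuits, ∀ Y ∈ O.circuits,
    Function.support X ⊆ Function.support Y → X = Y ∨ X = -Y
  /-- signed circuit elimination: `Z⁺ ⊆ (X⁺ ∪ Y⁺) \ {e}` and `Z⁻ ⊆ (X⁻ ∪ Y⁻) \ {e}` -/
  elimination : ∀ X ∈ O.circuits, ∀ Y ∈ O.circuits, X ≠ -Y → ∀ e, X e = 1 → Y e = -1 →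
    ∃ Z ∈ O.circuits, Z e = 0 ∧
      (∀ f, Z f = 1 → X f = 1 ∨ Y f = 1) ∧ (∀ f, Z f = -1 → X f = -1 ∨ Y f = -1)

/-- Orthogonality of sign vectors: either no element lies in both supports, or there are both an
element where the signs agree and an element where they are opposite. -/
def Orthogonal {β : Type*} (X Y : β → SignType) : Prop :=
  (∃ e, X e * Y e = 1) ↔ (∃ e, X e * Y e = -1)

/-- The dual: its signed circuits, i.e. the signed cocircuits of `O`, are the signings of the
cocircuits of the underlying matroid that are orthogonal to all signed circuits of `O`. -/
def dual {β : Type*} (O : SignedMatroid β) : SignedMatroid β where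
  toMatroid := O.toMatroid✶
  circuits := {Y | O.toMatroid.IsCocircuit (Function.support Y) ∧ ∀ X ∈ O.circuits, Orthogonal X Y}

/-- The deletion `O ＼ B`. -/
def delete {β : Type*} (O : SignedMatroid β) (B : Set β) : SignedMatroid β where
  toMatroid := O.toMatroid.delete B
  circuits := {X | X ∈ O.circuits ∧ Disjoint (Function.support X) B}

/-- The contraction `O ／ A`: its signed circuits are the restrictions of signed circuits of `O` to
the complement of `A` (set to zero on `A`) whose support is a circuit of the contracted matroid,
i.e. is nonempty and minimal among the nonempty supports of such restrictions. -/
def contract {β : Type*} (O : SignedMatroid β) (A : Set β) : SignedMatroid β where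
  toMatroid := O.toMatroid.contract A
  circuits := {Y | (O.toMatroid.contract A).IsCircuit (Function.support Y) ∧
    ∃ X ∈ O.circuits, Y = Aᶜ.indicator X}

/-- `N` is a minor of `O`. -/
def IsMinor {β : Type*} (N O : SignedMatroid β) : Prop :=
  ∃ A B : Set β, N = (O.contract A).delete B

/-- The flow lattice: the integer lattice generated by the signed circuits. -/
def flowLattice {β : Type*} (O : SignedMatroid β) : AddSubgroup (β → ℤ) :=
  AddSubgroup.closure {x | ∃ X ∈ O.circuits, x = fun e ↦ (X e : ℤ)}

/-- The coflow lattice: the integer lattice generated by the signed cocircuits. -/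
def coflowLattice {β : Type*} (O : SignedMatroid β) : AddSubgroup (β → ℤ) :=
  O.dual.flowLattice

/-- `x` is a nonzero `{0, 1, -1}`-vector with at most two nonzero entries. -/
def IsSmallVector {β : Type*} (x : β → ℤ) : Prop :=
  x ≠ 0 ∧ (∀ e, x e = 0 ∨ x e = 1 ∨ x e = -1) ∧ (Function.support x).encard ≤ 2

/-- Generalized series parallel: every simple minor (with nonempty ground set) has a nonzero
`{0, 1, -1}`-coflow with at most two nonzero entries. -/
def IsGSP {β : Type*} (O : SignedMatroid β) : Prop :=
  ∀ N : SignedMatroid β, N.IsMinor O → N.toMatroid.IsSimple → N.toMatroid.E.Nonempty →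
    ∃ x ∈ N.coflowLattice, IsSmallVector x

/-- Co-generalized series parallel: every cosimple minor (with nonempty ground set) has a nonzero
`{0, 1, -1}`-flow with at most two nonzero entries. -/
def IsCoGSP {β : Type*} (O : SignedMatroid β) : Prop :=
  ∀ N : SignedMatroid β, N.IsMinor O → N.toMatroid.IsCosimple → N.toMatroid.E.Nonempty →
    ∃ x ∈ N.flowLattice, IsSmallVector x

end SignedMatroid

/-! Call circuits D ∪ {f} and D ∪ {g} with f ≠ g, both outside D, an exchange pair. The proof
combines three facts.

(1) An exchange pair of a minor yields a small flow. The two circuits lift to signed circuits X, Y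
inside a set of nullity at most two, where at most one circuit avoids a given element that is not a
coloop. This makes signed elimination rigid (`strong_elimination`). If X and Y agree on D, then Y -
X cancels there. Otherwise a circuit Z eliminated at a conflict is inserted between them, and
induction on the number of conflicts gives an integer combination that vanishes on D and is ±1 at f
and g (`exists_mem_lattice`, `exists_isSmallVector_of_exchange`). A loop gives a small flow at once.

(2) A cosimple minor of a bicircular matroid with nonempty ground set has a loop or an exchange pair
(`exists_loop_or_exchange`). Bicircular matroids are transversal matroids in which each element,
viewed as an edge, lies in at most two of the sets, viewed as vertices; such presentations survive
deletion and contraction. Cosimplicity puts at least three edges at every vertex that is used. Two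
edges with equal ends give an exchange pair by symmetry. Otherwise a longest path argument with a
rotation produces a cycle with two chords, and the cycle together with either chord is a circuit.

(3) For the dual statement, every cocircuit has a signing orthogonal to all signed circuits
(`exists_signing`), and these signings satisfy elimination for modular pairs (`dual_isModOriented`).
Step (1) uses no more than that, so it applies to the dual. -/

/-! ### Sets of nullity at most two. -/

/-- `A` is a set of elements of `M` of nullity at most two. -/
def Matroid.NullityLeTwo {β : Type*} (M : Matroid β) (A : Set β) : Prop :=
  A ⊆ M.E ∧ ∃ (I : Set β) (g h : β), M.Indep I ∧ A ⊆ insert g (insert h I)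

/-- If C₁ and C₂ differed, then `s`, some `x` in C₁ \ C₂ and some `y` in C₂ could all be removed
from `A` without lowering the rank, so the nullity would be at least three. The circuit C₀ serves
only to make `s` removable. -/
theorem Matroid.NullityLeTwo.circuit_unique {β : Type*} {M : Matroid β} (hfin : M.E.Finite)
    {A : Set β} (hA : M.NullityLeTwo A) {C₀ C₁ C₂ : Set β} {s : β} (h₀ : M.IsCircuit C₀)
    (h₁ : M.IsCircuit C₁) (h₂ : M.IsCircuit C₂) (hC₀ : C₀ ⊆ A) (hC₁ : C₁ ⊆ A) (hC₂ : C₂ ⊆ A)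
    (hs₀ : s ∈ C₀) (hs₁ : s ∉ C₁) (hs₂ : s ∉ C₂) : C₁ = C₂ := by
  by_contra hne
  obtain ⟨hAE, I, g, h, hI, hAI⟩ := hA
  obtain ⟨x, hx₁, hx₂⟩ : ∃ x ∈ C₁, x ∉ C₂ := by
    by_contra! hcon
    exact hne (h₁.eq_of_subset_isCircuit h₂ hcon)
  obtain ⟨y, hy₂⟩ := h₂.nonempty
  set R := A \ {s, x, y} with hR
  have hxy : x ≠ y := fun h ↦ hx₂ (h ▸ hy₂)
  have hsx : s ≠ x := fun h ↦ hs₁ (h ▸ hx₁)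
  have hsy : s ≠ y := fun h ↦ hs₂ (h ▸ hy₂)
  have hRE : R ⊆ M.E := Set.sdiff_subset.trans hAE
  -- The order matters: C₂ avoids `s` and `x`, so it spans `y` first; then C₁ spans `x`, and finally
  -- C₀ spans `s`.
  have hyR : y ∈ M.closure R := by
    refine M.closure_subset_closure ?_ (h₂.mem_closure_sdiff_singleton_of_mem hy₂)
    rintro z ⟨hz, hzy⟩
    refine ⟨hC₂ hz, ?_⟩
    rintro (rfl | rfl | rfl)
    exacts [hs₂ hz, hx₂ hz, hzy rfl]
  have hxR : x ∈ M.closure R := by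
    refine M.closure_subset_closure_of_subset_closure ?_
      (h₁.mem_closure_sdiff_singleton_of_mem hx₁)
    rintro z ⟨hz, hzx⟩
    by_cases hzy : z = y
    · exact hzy ▸ hyR
    · refine M.subset_closure R hRE ⟨hC₁ hz, ?_⟩
      rintro (rfl | rfl | rfl)
      exacts [hs₁ hz, hzx rfl, hzy rfl]
  have hsR : s ∈ M.closure R := by
    refine M.closure_subset_closure_of_subset_closure ?_
      (h₀.mem_closure_sdiff_singleton_of_mem hs₀)
    rintro z ⟨hz, hzs⟩
    by_cases hzy : z = y
    · exact hzy ▸ hyR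
    by_cases hzx : z = x
    · exact hzx ▸ hxR
    · refine M.subset_closure R hRE ⟨hC₀ hz, ?_⟩
      rintro (rfl | rfl | rfl)
      exacts [hzs rfl, hzx rfl, hzy rfl]
  have hAR : A ⊆ M.closure R := by
    intro z hz
    by_cases hzy : z ∈ ({s, x, y} : Set β)
    · rcases hzy with rfl | rfl | rfl <;> assumption
    · exact M.subset_closure R hRE ⟨hz, hzy⟩
  have hrk : M.eRk A ≤ R.encard :=
    (M.eRk_mono hAR).trans ((M.eRk_closure_eq R).le.trans (M.eRk_le_encard R))
  have hI' : (I ∩ A).encard ≤ M.eRk A :=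
    (hI.subset Set.inter_subset_left).encard_le_eRk_of_subset Set.inter_subset_right
  have hAf : A.Finite := hfin.subset hAE
  have hRA : R.encard + 3 = A.encard := by
    have : ({s, x, y} : Set β) ⊆ A := by
      rintro z (rfl | rfl | rfl)
      exacts [hC₀ hs₀, hC₁ hx₁, hC₂ hy₂]
    rw [← Set.encard_sdiff_add_encard_of_subset this,
      Set.encard_eq_three.2 ⟨s, x, y, hsx, hsy, hxy, rfl⟩]
  have hA2 : A.encard ≤ (I ∩ A).encard + 2 := by
    have : A ⊆ (I ∩ A) ∪ {g, h} := by
      intro z hz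
      rcases hAI hz with rfl | rfl | h'
      · simp
      · simp
      · exact Or.inl ⟨h', hz⟩
    refine (Set.encard_le_encard this).trans ((Set.encard_union_le _ _).trans ?_)
    exact add_le_add le_rfl (Set.encard_insert_le _ _ |>.trans (by simp; norm_num))
  have hRf : R.encard ≠ ⊤ := (hAf.subset Set.sdiff_subset).encard_lt_top.ne
  have hle : R.encard + 3 ≤ R.encard + 2 := by
    rw [hRA]; exact hA2.trans (add_le_add (hI'.trans hrk) le_rfl)
  obtain ⟨n, hn⟩ := ENat.ne_top_iff_exists.1 hRf
  rw [← hn] at hle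
  norm_cast at hle
  omega

/-! ### Signed elimination in nullity two. -/

namespace SignedMatroid

variable {β : Type*}

@[simp]
theorem support_neg_sign (X : β → SignType) : Function.support (-X) = Function.support X := by
  ext e
  simp

/-- The signed circuit axioms, with elimination only for modular pairs, i.e. pairs of circuits
whose union has nullity two. -/
structure IsModOriented (O : SignedMatroid β) : Prop where
  finite : O.toMatroid.E.Finite
  isCircuit_iff : ∀ C, O.toMatroid.IsCircuit C ↔ ∃ X ∈ O.circuits, Function.support X = C
  neg_mem : ∀ X ∈ O.circuits, -X ∈ O.circuits
  eq_or_eq_neg : ∀ X ∈ O.circuits, ∀ Y ∈ O.circuits,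
    Function.support X ⊆ Function.support Y → X = Y ∨ X = -Y
  elimination : ∀ X ∈ O.circuits, ∀ Y ∈ O.circuits,
    O.toMatroid.NullityLeTwo (Function.support X ∪ Function.support Y) →
    X ≠ -Y → ∀ e, X e = 1 → Y e = -1 →
    ∃ Z ∈ O.circuits, Z e = 0 ∧ ∀ f, Z f = 0 ∨ Z f = X f ∨ Z f = Y f

theorem eq_zero_or_of_signs {x y z : SignType} (h₁ : z = 1 → x = 1 ∨ y = 1)
    (h₂ : z = -1 → x = -1 ∨ y = -1) : z = 0 ∨ z = x ∨ z = y := by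
  revert h₁ h₂; revert x y z; decide

theorem IsOriented.isModOriented {O : SignedMatroid β} (hO : O.IsOriented) :
    O.IsModOriented where
  finite := hO.finite
  isCircuit_iff := hO.isCircuit_iff
  neg_mem := hO.neg_mem
  eq_or_eq_neg := hO.eq_or_eq_neg
  elimination X hX Y hY _ hne e he he' := by
    obtain ⟨Z, hZ, hZe, h₁, h₂⟩ := hO.elimination X hX Y hY hne e he he'
    exact ⟨Z, hZ, hZe, fun f ↦ eq_zero_or_of_signs (h₁ f) (h₂ f)⟩

theorem IsModOriented.isCircuit {O : SignedMatroid β} (hO : O.IsModOriented) {X : β → SignType}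
    (hX : X ∈ O.circuits) : O.toMatroid.IsCircuit (Function.support X) :=
  (hO.isCircuit_iff _).2 ⟨X, hX, rfl⟩

/-- Nullity two forces the entries of `Z`. If `Z` vanished at an element of `Y` outside `X`, then
`X` and `Z` would both avoid that element and have equal supports by `circuit_unique`, although `Z q
= 0 ≠ X q`. The same holds with `X` and `Y` interchanged. -/
theorem IsModOriented.strong_elimination {O : SignedMatroid β} (hO : O.IsModOriented)
    {X Y : β → SignType} (hX : X ∈ O.circuits) (hY : Y ∈ O.circuits) {A : Set β}
    (hA : O.toMatroid.NullityLeTwo A) (hXA : Function.support X ⊆ A)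
    (hYA : Function.support Y ⊆ A) (hne : Function.support X ≠ Function.support Y) {q : β}
    (hXq : X q ≠ 0) (hq : Y q = -X q) :
    ∃ Z ∈ O.circuits, Z q = 0 ∧ (∀ f, Z f = 0 ∨ Z f = X f ∨ Z f = Y f) ∧
      (∀ f, X f = 0 → Z f = Y f) ∧ (∀ f, Y f = 0 → Z f = X f) ∧
      (∀ f, X f = Y f → Z f = X f) := by
  have key : ∀ X ∈ O.circuits, ∀ Y ∈ O.circuits, Function.support X ⊆ A →
      Function.support Y ⊆ A → Function.support X ≠ Function.support Y → ∀ q, X q ≠ 0 →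
      Y q = -X q → ∃ Z ∈ O.circuits, Z q = 0 ∧ (∀ f, Z f = 0 ∨ Z f = X f ∨ Z f = Y f) ∧
      (∀ f, X f = 0 → Z f = Y f) ∧ (∀ f, Y f = 0 → Z f = X f) ∧ Function.support Z ⊆ A := by
    intro X hX Y hY hXA hYA hne q hXq hq
    have h₁ : X ≠ -Y := by rintro rfl; simp at hne
    have h₂ : Y ≠ -X := by rintro rfl; simp at hne
    have hN : O.toMatroid.NullityLeTwo (Function.support X ∪ Function.support Y) :=
      ⟨(Set.union_subset hXA hYA).trans hA.1, by
        obtain ⟨I, g, h, hI, hAI⟩ := hA.2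
        exact ⟨I, g, h, hI, (Set.union_subset hXA hYA).trans hAI⟩⟩
    obtain ⟨Z, hZ, hZq, hZc⟩ : ∃ Z ∈ O.circuits, Z q = 0 ∧
        ∀ f, Z f = 0 ∨ Z f = X f ∨ Z f = Y f := by
      rcases h : X q with _ | _ | _
      · exact absurd h hXq
      · obtain ⟨Z, hZ, hZq, hZc⟩ := hO.elimination Y hY X hX (Set.union_comm _ _ ▸ hN) h₂ q
          (by rw [hq, h]; rfl) h
        exact ⟨Z, hZ, hZq, fun f ↦ by rcases hZc f with h | h | h <;> tauto⟩
      · exact hO.elimination X hX Y hY hN h₁ q h (by rw [hq, h]; rfl)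
    have hZA : Function.support Z ⊆ A := by
      intro f hf
      rcases hZc f with h | h | h
      · exact absurd h hf
      · exact hXA (by simpa [h] using hf)
      · exact hYA (by simpa [h] using hf)
    refine ⟨Z, hZ, hZq, hZc, fun f hf ↦ ?_, fun f hf ↦ ?_, hZA⟩
    · by_contra hcon
      have hZf : Z f = 0 := by
        rcases hZc f with h | h | h
        exacts [h, h.trans hf, absurd h hcon]
      have := hA.circuit_unique hO.finite (hO.isCircuit hY) (hO.isCircuit hX) (hO.isCircuit hZ)
        hYA hXA hZA (s := f) (fun h ↦ hcon (hZf.trans h.symm)) (by simpa using hf)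
        (by simpa using hZf)
      have h3 : q ∈ Function.support X := hXq
      rw [this] at h3
      exact h3 hZq
    · by_contra hcon
      have hZf : Z f = 0 := by
        rcases hZc f with h | h | h
        exacts [h, absurd h hcon, h.trans hf]
      have := hA.circuit_unique hO.finite (hO.isCircuit hX) (hO.isCircuit hY) (hO.isCircuit hZ)
        hXA hYA hZA (s := f) (fun h ↦ hcon (hZf.trans h.symm)) (by simpa using hf)
        (by simpa using hZf)
      have h3 : q ∈ Function.support Y := by simpa [hq] using hXq
      rw [this] at h3
      exact h3 hZq
  obtain ⟨Z, hZ, hZq, hZc, hZX, hZY, hZA⟩ := key X hX Y hY hXA hYA hne q hXq hq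
  refine ⟨Z, hZ, hZq, hZc, hZX, hZY, fun p hp ↦ ?_⟩
  by_contra hcon
  have hZp : Z p = 0 := by
    rcases hZc p with h | h | h
    exacts [h, absurd h hcon, absurd (h.trans hp.symm) hcon]
  have hXp : X p ≠ 0 := fun h ↦ hcon (hZp.trans h.symm)
  -- Eliminating `p` between `X` and `-Y` gives `Z'` with the support of `Z`, so `Z = ±Z'`. Neither
  -- sign is possible: at `t` both equal `X t`, while at `s` one is `Y s` and the other `-Y s`.
  obtain ⟨Z', hZ', hZ'p, -, hZ'X, hZ'Y, hZ'A⟩ := key X hX (-Y) (hO.neg_mem Y hY) hXA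
    (by simpa using hYA) (by simpa using hne) p hXp (by simp [hp])
  have hsupp := hA.circuit_unique hO.finite (hO.isCircuit hX) (hO.isCircuit hZ)
    (hO.isCircuit hZ') hXA hZA hZ'A (s := p) hXp (by simpa using hZp) (by simpa using hZ'p)
  obtain ⟨s, hs, hs'⟩ : ∃ s, Y s ≠ 0 ∧ X s = 0 := by
    by_contra! hcon
    exact hne ((hO.isCircuit hX).eq_of_superset_isCircuit (hO.isCircuit hY) hcon)
  obtain ⟨t, ht, ht'⟩ : ∃ t, X t ≠ 0 ∧ Y t = 0 := by
    by_contra! hcon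
    exact hne ((hO.isCircuit hY).eq_of_superset_isCircuit (hO.isCircuit hX) hcon).symm
  have e1 := hZX s hs'
  have e2 := hZ'X s hs'
  have e3 := hZY t ht'
  have e4 := hZ'Y t (by simpa using ht')
  rcases hO.eq_or_eq_neg Z hZ Z' hZ' hsupp.le with h | h
  · rw [h, e2] at e1
    simp only [Pi.neg_apply] at e1
    revert e1 hs; generalize Y s = y; revert y; decide
  · rw [h, Pi.neg_apply, e4] at e3
    revert e3 ht; generalize X t = y; revert y; decide

/-- In a set of nullity two, the restrictions to `T` of the signed circuits generate vectors which
live on the complements of two given circuits. -/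
theorem IsModOriented.exists_mem_lattice {O : SignedMatroid β} (hO : O.IsModOriented) {A T : Set β}
    (hA : O.toMatroid.NullityLeTwo A) (hT : T.Finite) (L : AddSubgroup (β → ℤ))
    (hL : ∀ X ∈ O.circuits, Function.support X ⊆ A → (∃ q ∈ T, X q = 0) →
      T.indicator (fun e ↦ (X e : ℤ)) ∈ L) :
    ∀ (n : ℕ), ∀ X ∈ O.circuits, ∀ Y ∈ O.circuits, Function.support X ⊆ A →
      Function.support Y ⊆ A → Function.support X ≠ Function.support Y → (∃ q ∈ T, X q = 0) →
      (∃ q ∈ T, Y q = 0) → {q ∈ T | X q ≠ 0 ∧ Y q = -X q}.ncard ≤ n →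
      ∃ x ∈ L, ∃ ε δ : ℤ, (ε = 1 ∨ ε = -1) ∧ (δ = 1 ∨ δ = -1) ∧
        (∀ e ∉ T, x e = 0) ∧ (∀ e ∈ T, X e = 0 → x e = ε * Y e) ∧
        (∀ e ∈ T, Y e = 0 → x e = δ * X e) ∧ (∀ e ∈ T, X e ≠ 0 → Y e ≠ 0 → x e = 0) := by
  intro n
  have base : ∀ X ∈ O.circuits, ∀ Y ∈ O.circuits, Function.support X ⊆ A →
      Function.support Y ⊆ A → (∃ q ∈ T, X q = 0) → (∃ q ∈ T, Y q = 0) →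
      {q ∈ T | X q ≠ 0 ∧ Y q = -X q} = ∅ →
      ∃ x ∈ L, ∃ ε δ : ℤ, (ε = 1 ∨ ε = -1) ∧ (δ = 1 ∨ δ = -1) ∧
        (∀ e ∉ T, x e = 0) ∧ (∀ e ∈ T, X e = 0 → x e = ε * Y e) ∧
        (∀ e ∈ T, Y e = 0 → x e = δ * X e) ∧ (∀ e ∈ T, X e ≠ 0 → Y e ≠ 0 → x e = 0) := by
    intro X hX Y hY hXA hYA hXT hYT hn
    -- Without conflicts on `T`, the vector `Y - X` already cancels on the common support.
    refine ⟨_, L.sub_mem (hL Y hY hYA hYT) (hL X hX hXA hXT), 1, -1, Or.inl rfl, Or.inr rfl,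
      fun e he ↦ by simp [he], fun e he h ↦ by simp [he, h], fun e he h ↦ by simp [he, h],
      fun e he h h' ↦ ?_⟩
    have : X e = Y e := by
      have h2 : e ∉ {q ∈ T | X q ≠ 0 ∧ Y q = -X q} := by simp [hn]
      have h3 : Y e ≠ -X e := fun h4 ↦ h2 ⟨he, h, h4⟩
      revert h h' h3; generalize X e = x; generalize Y e = y; revert x y; decide
    simp [he, this]
  induction n with
  | zero =>
    intro X hX Y hY hXA hYA _ hXT hYT hn
    rw [Nat.le_zero, Set.ncard_eq_zero (hT.subset (Set.sep_subset _ _))] at hn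
    exact base X hX Y hY hXA hYA hXT hYT hn
  | succ n ih =>
    intro X hX Y hY hXA hYA hne hXT hYT hn
    rcases Set.eq_empty_or_nonempty {q ∈ T | X q ≠ 0 ∧ Y q = -X q} with h | ⟨q, hqT, hq, hq'⟩
    · exact base X hX Y hY hXA hYA hXT hYT h
    -- The conflicts of (X, Z) and those of (Z, Y) are conflicts of (X, Y) other than `q`, so
    -- induction applies to both pairs. The zero of `Z` required by the induction is `q` itself.
    obtain ⟨Z, hZ, hZq, hZc, hZX, hZY, hZe⟩ :=
      hO.strong_elimination hX hY hA hXA hYA hne hq hq'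
    have hZA : Function.support Z ⊆ A := by
      intro f hf
      rcases hZc f with h | h | h
      · exact absurd h hf
      · exact hXA (by simpa [h] using hf)
      · exact hYA (by simpa [h] using hf)
    have hYq : Y q ≠ 0 := by simpa [hq'] using hq
    have hfin : {q ∈ T | X q ≠ 0 ∧ Y q = -X q}.Finite := hT.subset (Set.sep_subset _ _)
    have hcard : ∀ S ⊆ {q ∈ T | X q ≠ 0 ∧ Y q = -X q}, q ∉ S → S.ncard ≤ n := by
      intro S hS hqS
      have := Set.ncard_lt_ncard (ssubset_of_subset_of_ne hS
        (fun h ↦ hqS (h ▸ ⟨hqT, hq, hq'⟩))) hfin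
      omega
    obtain ⟨u, hu, ε₁, ε₂, h₁, h₂, hu0, hu1, hu2, hu3⟩ := ih X hX Z hZ hXA hZA
      (fun h ↦ (h ▸ hq : q ∈ Function.support Z) hZq) hXT ⟨q, hqT, hZq⟩ (hcard _ (by
        rintro r ⟨hr, hr1, hr2⟩
        refine ⟨hr, hr1, ?_⟩
        rcases hZc r with h | h | h
        · rw [h] at hr2; exact absurd (by simpa using hr2.symm) hr1
        · exfalso; rw [h] at hr2; revert hr2 hr1; generalize X r = x; revert x; decide
        · rw [← h, hr2]) (by rintro ⟨-, -, h⟩; rw [hZq] at h; exact hq (by simpa using h.symm)))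
    obtain ⟨w, hw, ε₃, ε₄, h₃, h₄, hw0, hw1, hw2, hw3⟩ := ih Z hZ Y hY hZA hYA
      (fun h ↦ (h ▸ hYq : q ∈ Function.support Z) hZq) ⟨q, hqT, hZq⟩ hYT (hcard _ (by
        rintro r ⟨hr, hr1, hr2⟩
        rcases hZc r with h | h | h
        · exact absurd h hr1
        · exact ⟨hr, h ▸ hr1, by rw [hr2, h]⟩
        · exfalso; rw [h] at hr2 hr1; revert hr2 hr1; generalize Y r = x; revert x; decide)
        (by rintro ⟨-, h, -⟩; exact h hZq))
    have hc : ε₂ * ε₃ = 1 ∨ ε₂ * ε₃ = -1 := by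
      rcases h₂ with rfl | rfl <;> rcases h₃ with rfl | rfl <;> simp
    -- The coefficient is chosen for the elements where only `Z` vanishes: there `Y = -X`, so `u`
    -- contributes ε₂X and the multiple of `w` contributes -ε₂ε₃²X.
    refine ⟨u + (ε₂ * ε₃) • w, L.add_mem hu (L.zsmul_mem hw _), ε₁, ε₂ * ε₃ * ε₄, h₁, ?_,
      ?_, ?_, ?_, ?_⟩
    · rcases hc with h | h <;> rcases h₄ with rfl | rfl <;> simp [h]
    · intro e he; simp [hu0 e he, hw0 e he]
    · intro e he h
      have hZ1 := hZX e h
      have hwe : w e = 0 := by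
        by_cases h' : Y e = 0
        · rw [hw1 e he (hZ1.trans h'), h']; simp
        · exact hw3 e he (hZ1 ▸ h') h'
      simp [hwe, hu1 e he h, hZ1]
    · intro e he h
      have hZ1 := hZY e h
      have hue : u e = 0 := by
        by_cases h' : X e = 0
        · rw [hu2 e he (hZ1.trans h'), h']; simp
        · exact hu3 e he h' (hZ1 ▸ h')
      simp [hue, hw2 e he h, hZ1, mul_assoc]
    · intro e he h h'
      by_cases hZ0 : Z e = 0
      · have hYX : Y e = -X e := by
          have h5 : X e ≠ Y e := fun h6 ↦ h ((hZe e h6).symm.trans hZ0)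
          revert h h' h5; generalize X e = x; generalize Y e = y; revert x y; decide
        have : ε₃ * ε₃ = 1 := by rcases h₃ with rfl | rfl <;> simp
        simp only [Pi.add_apply, Pi.smul_apply, smul_eq_mul, hu2 e he hZ0, hw1 e he hZ0, hYX,
          SignType.coe_neg]
        linear_combination (-ε₂ * (X e : ℤ)) * this
      · simp [hu3 e he h hZ0, hw3 e he hZ0 h']

end SignedMatroid

/-! ### Small flows from exchange pairs and loops of a minor. -/

namespace SignedMatroid

variable {β : Type*}

/-- Both circuits lift to circuits of `O` by adding elements of a basis `J` of `A`, and `T ∪ J` has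
nullity at most two, so `exists_mem_lattice` cancels `D`. Leaving `L` abstract lets one statement
serve the flows of a minor and, applied to the dual, its coflows. -/
theorem IsModOriented.exists_isSmallVector_of_exchange {O : SignedMatroid β}
    (hO : O.IsModOriented) (A B : Set β) {D : Set β} {f h : β} (hfh : f ≠ h) (hfD : f ∉ D)
    (hhD : h ∉ D) (hf : (O.toMatroid.contract A |>.delete B).IsCircuit (insert f D))
    (hh : (O.toMatroid.contract A |>.delete B).IsCircuit (insert h D)) (L : AddSubgroup (β → ℤ))
    (hL : ∀ X ∈ O.circuits,
      (O.toMatroid.contract A |>.delete B).IsCircuit (Function.support (Aᶜ.indicator X)) →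
      (fun e ↦ ((Aᶜ.indicator X e : SignType) : ℤ)) ∈ L) :
    ∃ x ∈ L, IsSmallVector x := by
  classical
  set M := O.toMatroid with hM
  rw [Matroid.delete_isCircuit_iff] at hf hh
  obtain ⟨hf, hfB⟩ := hf
  obtain ⟨hh, hhB⟩ := hh
  obtain ⟨J, hJ⟩ := M.exists_isBasis' A
  set T := insert f (insert h D) with hTdef
  have hfT : insert f D ⊆ T := Set.insert_subset_insert (Set.subset_insert _ _)
  have hhT : insert h D ⊆ T := Set.subset_insert _ _
  have hTu : T ⊆ insert f D ∪ insert h D := by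
    rintro e (rfl | rfl | he) <;> simp [*]
  have hTE : T ⊆ (M.contract A).E := hTu.trans (Set.union_subset hf.subset_ground hh.subset_ground)
  have hTB : Disjoint T B := Set.disjoint_of_subset_left hTu (Set.disjoint_union_left.2 ⟨hfB, hhB⟩)
  have hTA : Disjoint T A := by
    rw [Matroid.contract_ground] at hTE
    exact (Set.subset_sdiff.1 hTE).2
  have hTE' : T ⊆ M.E := hTE.trans (by rw [Matroid.contract_ground]; exact Set.sdiff_subset)
  have hJA := hJ.subset
  have hDind : M.Indep (D ∪ J) := by
    have : (M.contract A).Indep D := by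
      have := hf.sdiff_singleton_indep (Set.mem_insert f D)
      rwa [Set.insert_sdiff_self_of_notMem hfD] at this
    exact (hJ.contract_indep_iff.1 this).1
  have hN : M.NullityLeTwo (T ∪ J) := by
    refine ⟨Set.union_subset hTE' hJ.indep.subset_ground, D ∪ J, f, h, hDind, ?_⟩
    rintro e ((rfl | rfl | he) | he) <;> simp [*]
  have hdep : ∀ K, M.IsCircuit K → K ⊆ T ∪ J → (M.contract A).Dep (K ∩ T) := by
    intro K hK hKT
    rw [hJ.contract_dep_iff]
    refine ⟨hK.dep.superset ?_ (Set.union_subset (Set.inter_subset_right.trans hTE')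
      hJ.indep.subset_ground), (hTA.mono_left Set.inter_subset_right).symm⟩
    intro e he
    rcases hKT he with h' | h'
    · exact Or.inl ⟨he, h'⟩
    · exact Or.inr h'
  have hlift : ∀ C, (M.contract A).IsCircuit C → C ⊆ T →
      ∃ K, M.IsCircuit K ∧ K ⊆ C ∪ J ∧ K ∩ T = C := by
    intro C hC hCT
    obtain ⟨K, hKC, hK⟩ := (hJ.contract_dep_iff.1 hC.dep).1.exists_isCircuit_subset
    refine ⟨K, hK, hKC, hC.eq_of_dep_subset
      (hdep K hK (hKC.trans (Set.union_subset_union_left _ hCT))) ?_⟩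
    rintro e ⟨he, heT⟩
    rcases hKC he with h' | h'
    · exact h'
    · exact absurd (hJA h') (Set.disjoint_left.1 hTA heT)
  obtain ⟨K₁, hK₁, hK₁s, hK₁T⟩ := hlift _ hf hfT
  obtain ⟨K₂, hK₂, hK₂s, hK₂T⟩ := hlift _ hh hhT
  have hK₁s' : K₁ ⊆ T ∪ J := hK₁s.trans (Set.union_subset_union_left _ hfT)
  have hK₂s' : K₂ ⊆ T ∪ J := hK₂s.trans (Set.union_subset_union_left _ hhT)
  -- The trace of `K` on `T` contains a circuit `C` of the contraction. A lift of `C` avoids `q` as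
  -- `K` does, so the two are equal by `circuit_unique`. A circuit covering all of `T` need not
  -- restrict to a circuit, which is why `exists_mem_lattice` only uses circuits with a zero in `T`.
  have hcirc : ∀ K, M.IsCircuit K → K ⊆ T ∪ J → (∃ q ∈ T, q ∉ K) →
      (M.contract A).IsCircuit (K ∩ T) := by
    rintro K hK hKT ⟨q, hqT, hqK⟩
    obtain ⟨C, hCK, hC⟩ := (hdep K hK hKT).exists_isCircuit_subset
    obtain ⟨K₀, hK₀, hK₀C, hK₀T⟩ := hlift C hC (hCK.trans Set.inter_subset_right)
    obtain ⟨K', hK', hK's, hqK'⟩ : ∃ K', M.IsCircuit K' ∧ K' ⊆ T ∪ J ∧ q ∈ K' := by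
      rcases hTu hqT with h' | h'
      · rw [← hK₁T] at h'
        exact ⟨K₁, hK₁, hK₁s', h'.1⟩
      · rw [← hK₂T] at h'
        exact ⟨K₂, hK₂, hK₂s', h'.1⟩
    have hqK₀ : q ∉ K₀ := fun h' ↦ hqK (hCK (hK₀T ▸ ⟨h', hqT⟩)).1
    have := hN.circuit_unique hO.finite hK' hK hK₀ hK's hKT
      (hK₀C.trans (Set.union_subset_union_left _ (hCK.trans Set.inter_subset_right))) hqK' hqK hqK₀
    rw [this, hK₀T]
    exact hC
  obtain ⟨X, hX, hXK⟩ := (hO.isCircuit_iff K₁).1 hK₁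
  obtain ⟨Y, hY, hYK⟩ := (hO.isCircuit_iff K₂).1 hK₂
  have hX0 : ∀ e ∈ T, X e = 0 ↔ e = h := by
    intro e he
    have h1 : e ∈ K₁ ↔ e ∈ insert f D := by rw [← hK₁T]; simp [he]
    have h2 : e ∈ K₁ ↔ X e ≠ 0 := by rw [← hXK]; rfl
    rw [← not_iff_not, ← ne_eq, ← h2, h1]
    constructor
    · rintro h' rfl
      rcases h' with h' | h'
      exacts [hfh h'.symm, hhD h']
    · rcases he with rfl | rfl | he <;> simp [*]
  have hY0 : ∀ e ∈ T, Y e = 0 ↔ e = f := by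
    intro e he
    have h1 : e ∈ K₂ ↔ e ∈ insert h D := by rw [← hK₂T]; simp [he]
    have h2 : e ∈ K₂ ↔ Y e ≠ 0 := by rw [← hYK]; rfl
    rw [← not_iff_not, ← ne_eq, ← h2, h1]
    constructor
    · rintro h' rfl
      rcases h' with h' | h'
      exacts [hfh h', hfD h']
    · rcases he with rfl | rfl | he <;> simp [*]
  have hfmem : f ∈ T := by simp [hTdef]
  have hhmem : h ∈ T := by simp [hTdef]
  obtain ⟨x, hxL, ε, δ, hε, hδ, hx1, hx2, hx3, hx4⟩ :=
    hO.exists_mem_lattice hN (hO.finite.subset hTE') L (by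
      intro Z hZ hZT ⟨q, hqT, hqZ⟩
      have hc := hcirc _ (hO.isCircuit hZ) hZT ⟨q, hqT, by simpa using hqZ⟩
      have heq : Aᶜ.indicator Z = T.indicator Z := by
        ext e
        by_cases heT : e ∈ T
        · simp [heT, Set.disjoint_left.1 hTA heT]
        · by_cases heA : e ∈ A
          · simp [heT, heA]
          · have : Z e = 0 := by
              by_contra hne
              rcases hZT hne with h' | h'
              exacts [heT h', heA (hJA h')]
            simp [heT, heA, this]
      have hs : Function.support (Aᶜ.indicator Z) = Function.support Z ∩ T := by
        rw [heq, Set.support_indicator, Set.inter_comm]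
      have : T.indicator (fun e ↦ (Z e : ℤ)) =
          fun e ↦ ((Aᶜ.indicator Z e : SignType) : ℤ) := by
        ext e
        rw [heq]
        by_cases heT : e ∈ T <;> simp [heT]
      rw [this]
      refine hL Z hZ ?_
      rw [hs, Matroid.delete_isCircuit_iff]
      exact ⟨hc, hTB.mono_left Set.inter_subset_right⟩) _ X hX Y hY
      (hXK ▸ hK₁s') (hYK ▸ hK₂s') (fun h' ↦ by
        have : h ∈ Function.support X := h' ▸ fun h'' ↦ hfh ((hY0 h hhmem).1 h'').symm
        exact this ((hX0 h hhmem).2 rfl)) ⟨h, hhmem, (hX0 h hhmem).2 rfl⟩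
      ⟨f, hfmem, (hY0 f hfmem).2 rfl⟩ le_rfl
  have hXf : X f ≠ 0 := fun h' ↦ hfh ((hX0 f hfmem).1 h')
  have hYh : Y h ≠ 0 := fun h' ↦ hfh ((hY0 h hhmem).1 h').symm
  have hxf := hx3 f hfmem ((hY0 f hfmem).2 rfl)
  have hxh := hx2 h hhmem ((hX0 h hhmem).2 rfl)
  have hrest : ∀ e, e ≠ f → e ≠ h → x e = 0 := by
    intro e hef heh
    by_cases he : e ∈ T
    · exact hx4 e he (fun h' ↦ heh ((hX0 e he).1 h')) (fun h' ↦ hef ((hY0 e he).1 h'))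
    · exact hx1 e he
  have hunit : ∀ (s : SignType) (ε : ℤ), (ε = 1 ∨ ε = -1) → s ≠ 0 →
      ε * (s : ℤ) = 1 ∨ ε * (s : ℤ) = -1 := by
    rintro s ε (rfl | rfl) hs <;> revert hs <;> cases s <;> simp
  have hxf' := hunit _ _ hδ hXf
  have hxh' := hunit _ _ hε hYh
  rw [← hxf] at hxf'
  rw [← hxh] at hxh'
  refine ⟨x, hxL, ?_, ?_, ?_⟩
  · rintro rfl
    simp at hxf'
  · intro e
    by_cases h1 : e = f
    · exact Or.inr (h1 ▸ hxf')
    by_cases h2 : e = h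
    · exact Or.inr (h2 ▸ hxh')
    exact Or.inl (hrest e h1 h2)
  · refine (Set.encard_le_encard (t := {f, h}) ?_).trans (Set.encard_pair hfh).le
    intro e he
    by_contra hcon
    simp only [Set.mem_insert_iff, Set.mem_singleton_iff, not_or] at hcon
    exact he (hrest e hcon.1 hcon.2)

/-- A loop of a minor is a small flow. -/
theorem IsModOriented.exists_isSmallVector_of_isLoop {O : SignedMatroid β}
    (hO : O.IsModOriented) (A B : Set β) {f : β}
    (hf : (O.toMatroid.contract A |>.delete B).IsLoop f) (L : AddSubgroup (β → ℤ))
    (hL : ∀ X ∈ O.circuits,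
      (O.toMatroid.contract A |>.delete B).IsCircuit (Function.support (Aᶜ.indicator X)) →
      (fun e ↦ ((Aᶜ.indicator X e : SignType) : ℤ)) ∈ L) :
    ∃ x ∈ L, IsSmallVector x := by
  have hf' := Matroid.singleton_isCircuit.2 hf
  have hc := (Matroid.delete_isCircuit_iff.1 hf').1
  obtain ⟨J, hJ⟩ := O.toMatroid.exists_isBasis' A
  obtain ⟨hd, hdA⟩ := hJ.contract_dep_iff.1 hc.dep
  obtain ⟨K, hKs, hK⟩ := hd.exists_isCircuit_subset
  have hfK : f ∈ K := by
    by_contra hcon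
    refine hK.not_indep (hJ.indep.subset fun e he ↦ ?_)
    rcases hKs he with h | h
    · exact absurd (h ▸ he) hcon
    · exact h
  obtain ⟨X, hX, rfl⟩ := (hO.isCircuit_iff K).1 hK
  have hfA : f ∉ A := by simpa using hdA
  have h0 : ∀ e ≠ f, Aᶜ.indicator X e = 0 := by
    intro e he
    by_cases heA : e ∈ A
    · simp [heA]
    · by_contra hcon
      rw [Set.indicator_of_mem (by simpa using heA)] at hcon
      rcases hKs hcon with h | h
      exacts [he h, heA (hJ.subset h)]
  have h1 : Aᶜ.indicator X f = X f := Set.indicator_of_mem (by simpa using hfA) _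
  have hs : Function.support (Aᶜ.indicator X) = {f} := by
    ext e
    by_cases he : e = f
    · subst he
      simpa only [Function.mem_support, h1, Set.mem_singleton_iff, iff_true] using hfK
    · simp only [Function.mem_support, h0 e he, Set.mem_singleton_iff, he,
        ne_eq, not_true_eq_false]
  have hXf : X f ≠ 0 := hfK
  refine ⟨_, hL X hX (hs ▸ hf'), ?_, ?_, ?_⟩
  · intro h
    have := congrFun h f
    simp only [h1, Pi.zero_apply] at this
    revert this hXf; cases X f <;> simp
  · intro e
    dsimp only
    cases Aᶜ.indicator X e <;> simp
  · refine (Set.encard_le_encard (t := {f}) ?_).trans (by simp)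
    intro e he
    by_contra hcon
    exact he (by simp [h0 e hcon])

end SignedMatroid

/-! ### Circuits meeting cocircuits and small sets. -/

namespace Matroid

variable {β : Type*}

/-- The complement of `K` is a hyperplane, so adding any element of `K` to its basis `I` gives a
base. The circuit is the one that `e'` closes with `I ∪ {e}`; it contains `e` because `I ∪ {e'}` is
independent too. -/
theorem IsCocircuit.exists_isCircuit_pair {M : Matroid β} {K I : Set β} (hK : M.IsCocircuit K)
    (hI : M.IsBasis I (M.E \ K)) {e e' : β} (he : e ∈ K) (he' : e' ∈ K) (hne : e ≠ e') :
    M.Indep (insert e I) ∧ ∃ C, M.IsCircuit C ∧ C ⊆ insert e (insert e' I) ∧ e ∈ C ∧ e' ∈ C := by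
  have hIK : ∀ x ∈ I, x ∉ K := fun x hx ↦ (hI.subset hx).2
  have key : ∀ e ∈ K, M.Indep (insert e I) := by
    intro e he
    by_contra hcon
    have hd : M.Dep (insert e I) :=
      ⟨hcon, Set.insert_subset (hK.subset_ground he) hI.indep.subset_ground⟩
    obtain ⟨C, hCs, hC⟩ := hd.exists_isCircuit_subset
    refine hC.inter_isCocircuit_ne_singleton hK (e := e) ?_
    have heC : e ∈ C := by
      by_contra heC
      exact hC.not_indep (hI.indep.subset ((Set.subset_insert_iff_of_notMem heC).1 hCs))
    ext x
    constructor
    · rintro ⟨hx, hxK⟩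
      rcases hCs hx with rfl | h
      exacts [rfl, absurd hxK (hIK x h)]
    · rintro rfl
      exact ⟨heC, he⟩
  refine ⟨key e he, ?_⟩
  have hmin := isCocircuit_iff_minimal_compl_nonspanning.1 hK
  have hsp : M.Spanning (M.E \ (K \ {e})) := by
    by_contra hcon
    exact (hmin.le_of_le hcon Set.sdiff_subset he).2 rfl
  have hcl : M.E ⊆ M.closure (insert e I) := by
    have : M.E \ (K \ {e}) ⊆ M.closure (insert e I) := by
      intro x hx
      by_cases hxe : x = e
      · subst hxe
        exact M.subset_closure _ (key x he).subset_ground (Set.mem_insert x I)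
      · have hxK : x ∉ K := fun h ↦ hx.2 ⟨h, hxe⟩
        exact M.closure_subset_closure (Set.subset_insert e I) (hI.subset_closure ⟨hx.1, hxK⟩)
    rw [← hsp.closure_eq]
    exact M.closure_subset_closure_of_subset_closure this
  have he'I : e' ∉ insert e I := by
    rintro (h | h)
    exacts [hne h.symm, hIK e' h he']
  obtain ⟨C, hCs, hC, he'C⟩ :=
    exists_isCircuit_of_mem_closure (hcl (hK.subset_ground he')) he'I
  refine ⟨C, hC, hCs.trans (Set.insert_comm _ _ _).subset, ?_, he'C⟩
  by_contra heC
  refine hC.not_indep ((key e' he').subset fun x hx ↦ ?_)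
  rcases hCs hx with h | h | h
  exacts [Or.inl h, absurd (h ▸ hx) heC, Or.inr h]

/-- The complement of `A` has rank at least the rank of `M` minus two, so a basis `J` of it becomes
dependent when three elements are added. The resulting circuits test orthogonality on `A` three
entries at a time. -/
theorem exists_isCircuit_subset_triple {M : Matroid β} (hfin : M.E.Finite) {A : Set β}
    (hA : M✶.NullityLeTwo A) {a b c : β} (ha : a ∈ A) (hb : b ∈ A) (hc : c ∈ A)
    (hab : a ≠ b) (hac : a ≠ c) (hbc : b ≠ c) :
    ∃ C, M.IsCircuit C ∧ (a ∈ C ∨ b ∈ C ∨ c ∈ C) ∧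
      ∀ z ∈ A, z ∈ C → z = a ∨ z = b ∨ z = c := by
  obtain ⟨hAE, I, g, h, hI, hAI⟩ := hA
  obtain ⟨B', hB', hIB'⟩ := hI.exists_isBase_superset
  have hB := hB'.compl_isBase_of_dual
  set B := M.E \ B'
  obtain ⟨J, hJ, hJB⟩ := 
    (hB.indep.subset (Set.inter_subset_left (t := M.E \ A))).subset_isBasis_of_subset
    (Set.inter_subset_right)
  have hBJ : B.encard ≤ J.encard + 2 := by
    have : B ⊆ J ∪ {g, h} := by
      intro z hz
      by_cases hzA : z ∈ A
      · rcases hAI hzA with rfl | rfl | h'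
        · simp
        · simp
        · exact absurd (hIB' h') hz.2
      · exact Or.inl (hJB ⟨hz, hz.1, hzA⟩)
    refine (Set.encard_le_encard this).trans ((Set.encard_union_le _ _).trans ?_)
    exact add_le_add le_rfl (Set.encard_insert_le _ _ |>.trans (by simp; norm_num))
  have hdisj : Disjoint J {a, b, c} := by
    rw [Set.disjoint_left]
    rintro z hz (rfl | rfl | rfl)
    exacts [(hJ.subset hz).2 ha, (hJ.subset hz).2 hb, (hJ.subset hz).2 hc]
  have hnd : ¬ M.Indep (J ∪ {a, b, c}) := by
    intro hcon
    obtain ⟨B₂, hB₂, hs⟩ := hcon.exists_isBase_superset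
    have h1 := (Set.encard_le_encard hs).trans (hB₂.encard_eq_encard_of_isBase hB).le
    rw [Set.encard_union_eq hdisj, Set.encard_eq_three.2 ⟨a, b, c, hab, hac, hbc, rfl⟩] at h1
    have h2 := h1.trans hBJ
    have hJf : J.encard ≠ ⊤ := (hfin.subset hJ.indep.subset_ground).encard_lt_top.ne
    obtain ⟨n, hn⟩ := ENat.ne_top_iff_exists.1 hJf
    rw [← hn] at h2
    norm_cast at h2
    omega
  have hd : M.Dep (J ∪ {a, b, c}) := by
    refine ⟨hnd, Set.union_subset hJ.indep.subset_ground ?_⟩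
    rintro z (rfl | rfl | rfl)
    exacts [hAE ha, hAE hb, hAE hc]
  obtain ⟨C, hCs, hC⟩ := hd.exists_isCircuit_subset
  refine ⟨C, hC, ?_, ?_⟩
  · by_contra! hcon
    refine hC.not_indep (hJ.indep.subset fun z hz ↦ ?_)
    rcases hCs hz with h | rfl | rfl | rfl
    exacts [h, absurd hz hcon.1, absurd hz hcon.2.1, absurd hz hcon.2.2]
  · intro z hzA hz
    rcases hCs hz with h | h
    · exact absurd hzA (hJ.subset h).2
    · exact h

/-- A property of bases of `X` which is preserved by exchanging one element holds for all bases. -/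
theorem IsBasis.exchange_induction {M : Matroid β} (hfin : M.E.Finite) {X : Set β}
    (P : Set β → Prop) (hP : ∀ I a b, M.IsBasis I X → M.IsBasis (insert b (I \ {a})) X → b ∈ X →
      P I → P (insert b (I \ {a}))) {I I' : Set β} (hI : M.IsBasis I X) (hI' : M.IsBasis I' X)
    (h : P I) : P I' := by
  have key : ∀ n, ∀ I, M.IsBasis I X → P I → (I \ I').ncard ≤ n → P I' := by
    intro n
    induction n with
    | zero =>
      intro I hI h hn
      rw [Nat.le_zero, Set.ncard_eq_zero ((hfin.subset hI.indep.subset_ground).subset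
        Set.sdiff_subset), Set.sdiff_eq_empty] at hn
      exact (hI.eq_of_subset_indep hI'.indep hn hI'.subset) ▸ h
    | succ n ih =>
      intro I hI h hn
      by_cases hII : I ⊆ I'
      · exact (hI.eq_of_subset_indep hI'.indep hII hI'.subset) ▸ h
      obtain ⟨a, ha, ha'⟩ := Set.not_subset.1 hII
      obtain ⟨b, hb, hbI⟩ := hI.isBase_restrict.exchange hI'.isBase_restrict ⟨ha, ha'⟩
      have hbI' : M.IsBasis (insert b (I \ {a})) X := (isBase_restrict_iff hI.subset_ground).1 hbI
      refine ih _ hbI' (hP I a b hI hbI' (hI'.subset hb.1) h) ?_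
      have : (insert b (I \ {a})) \ I' ⊂ I \ I' := by
        refine ssubset_of_subset_of_ne ?_ ?_
        · rintro z ⟨rfl | hz, hz'⟩
          · exact absurd hb.1 hz'
          · exact ⟨hz.1, hz'⟩
        · intro heq
          have : a ∈ (insert b (I \ {a})) \ I' := heq ▸ ⟨ha, ha'⟩
          rcases this.1 with h1 | h1
          · exact ha' (h1 ▸ hb.1)
          · exact h1.2 rfl
      have := Set.ncard_lt_ncard this ((hfin.subset hI.indep.subset_ground).subset
        Set.sdiff_subset)
      omega
  exact key _ I hI h le_rfl

end Matroid

/-! ### Signing a cocircuit orthogonally to all circuits. -/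

namespace SignedMatroid

variable {β : Type*}

/-- `σ` signs the elements of `K` such that every signed circuit in `I ∪ {e, e'}` which contains
two elements `e, e'` of `K` is orthogonal to it. -/
def PairOrthogonal (O : SignedMatroid β) (K I : Set β) (σ : β → SignType) : Prop :=
  ∀ e ∈ K, ∀ e' ∈ K, e ≠ e' → ∀ X ∈ O.circuits, Function.support X ⊆ insert e (insert e' I) →
    X e ≠ 0 → σ e * X e = -(σ e' * X e')

theorem IsOriented.exists_ne_zero_of_isCocircuit {O : SignedMatroid β} (hO : O.IsOriented)
    {K : Set β} (hK : O.toMatroid.IsCocircuit K) {X : β → SignType} (hX : X ∈ O.circuits) {e : β}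
    (he : e ∈ K) (hXe : X e ≠ 0) : ∃ e' ∈ K, e' ≠ e ∧ X e' ≠ 0 := by
  by_contra! hcon
  refine (hO.isModOriented.isCircuit hX).inter_isCocircuit_ne_singleton hK (e := e) ?_
  ext z
  constructor
  · rintro ⟨hz, hzK⟩
    by_contra hze
    exact hz (hcon z hzK hze)
  · rintro rfl
    exact ⟨hXe, he⟩

theorem IsOriented.exists_pair {O : SignedMatroid β} (hO : O.IsOriented) {K I : Set β}
    (hK : O.toMatroid.IsCocircuit K) (hI : O.toMatroid.IsBasis I (O.toMatroid.E \ K)) {e e' : β}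
    (he : e ∈ K) (he' : e' ∈ K) (hne : e ≠ e') {s : SignType} (hs : s ≠ 0) :
    ∃ X ∈ O.circuits, Function.support X ⊆ insert e (insert e' I) ∧ X e = s ∧ X e' ≠ 0 := by
  obtain ⟨-, C, hC, hCs, heC, he'C⟩ := hK.exists_isCircuit_pair hI he he' hne
  obtain ⟨X, hX, rfl⟩ := (hO.isCircuit_iff C).1 hC
  by_cases h : X e = s
  · exact ⟨X, hX, hCs, h, he'C⟩
  · refine ⟨-X, hO.neg_mem X hX, by simpa using hCs, ?_, by simpa using he'C⟩
    have : X e ≠ 0 := heC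
    simp only [Pi.neg_apply]
    revert h hs this; generalize X e = x; revert x s; decide

theorem IsOriented.eq_or_eq_neg_of_pair {O : SignedMatroid β} (hO : O.IsOriented) {K I : Set β}
    (hK : O.toMatroid.IsCocircuit K) (hI : O.toMatroid.IsBasis I (O.toMatroid.E \ K)) {e e' : β}
    (he : e ∈ K) (he' : e' ∈ K) (hne : e ≠ e') {X Y : β → SignType} (hX : X ∈ O.circuits)
    (hY : Y ∈ O.circuits) (hXs : Function.support X ⊆ insert e (insert e' I))
    (hYs : Function.support Y ⊆ insert e (insert e' I)) : X = Y ∨ X = -Y := by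
  have hind := (hK.exists_isCircuit_pair hI he' he hne.symm).1
  have h1 := (hO.isModOriented.isCircuit hX).eq_fundCircuit_of_subset hind hXs
  have h2 := (hO.isModOriented.isCircuit hY).eq_fundCircuit_of_subset hind hYs
  exact hO.eq_or_eq_neg X hX Y hY (h1.trans h2.symm).subset

/-- Signs are fixed relative to a base point `e₀`: the circuit in `I ∪ {e₀, e}` with value 1 at `e₀`
dictates the sign of `e`. For two other elements, the circuit in `I ∪ {e, e'}` arises by eliminating
`e₀` between the circuits of `e` and `e'`, so the choices are consistent. -/
theorem IsOriented.exists_pairOrthogonal {O : SignedMatroid β} (hO : O.IsOriented) {K I : Set β}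
    (hK : O.toMatroid.IsCocircuit K) (hI : O.toMatroid.IsBasis I (O.toMatroid.E \ K)) :
    ∃ σ : β → SignType, Function.support σ = K ∧ O.PairOrthogonal K I σ := by
  classical
  obtain ⟨e₀, he₀⟩ := hK.nonempty
  have hIK : ∀ x ∈ K, x ∉ I := fun x hx hx' ↦ (hI.subset hx').2 hx
  have hch : ∀ e, ∃ X : β → SignType, e ∈ K → e ≠ e₀ → X ∈ O.circuits ∧
      Function.support X ⊆ insert e₀ (insert e I) ∧ X e₀ = 1 ∧ X e ≠ 0 := by
    intro e
    by_cases h : e ∈ K ∧ e ≠ e₀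
    · obtain ⟨X, h1, h2, h3, h4⟩ := hO.exists_pair hK hI he₀ h.1 h.2.symm (s := 1) (by decide)
      exact ⟨X, fun _ _ ↦ ⟨h1, h2, h3, h4⟩⟩
    · exact ⟨0, fun h1 h2 ↦ absurd ⟨h1, h2⟩ h⟩
  choose F hF using hch
  refine ⟨fun e ↦ if e ∈ K then (if e = e₀ then 1 else -F e e) else 0, ?_, ?_⟩
  · ext e
    simp only [Function.mem_support]
    by_cases h : e ∈ K
    · by_cases h' : e = e₀
      · simp [h']
      · simpa [h, h'] using (hF e h h').2.2.2
    · simp [h]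
  · have h0 : ∀ e ∈ K, e ≠ e₀ → ∀ X ∈ O.circuits, Function.support X ⊆ insert e₀ (insert e I) →
        X e₀ = F e e * X e := by
      intro e he hee X hX hXs
      obtain ⟨h1, h2, h3, h4⟩ := hF e he hee
      rcases hO.eq_or_eq_neg_of_pair hK hI he₀ he hee.symm hX h1 hXs h2 with rfl | rfl
      · rw [h3]; revert h4; generalize F e e = x; revert x; decide
      · simp only [Pi.neg_apply, h3]; revert h4; generalize F e e = x; revert x; decide
    intro e he e' he' hne X hX hXs hXe
    simp only [he, he', if_true]
    by_cases hee : e = e₀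
    · subst hee
      simpa [hne.symm] using h0 e' he' hne.symm X hX hXs
    by_cases hee' : e' = e₀
    · subst hee'
      have := h0 e he hne X hX (by rwa [Set.insert_comm])
      simp [hne, this]
    · simp only [hee, hee', if_false]
      obtain ⟨h1, h2, h3, h4⟩ := hF e he hee
      obtain ⟨h1', h2', h3', h4'⟩ := hF e' he' hee'
      have hA : O.toMatroid.NullityLeTwo (insert e (insert e' (insert e₀ I))) := by
        refine ⟨?_, insert e₀ I, e, e', (hK.exists_isCircuit_pair hI he₀ he (Ne.symm hee)).1,
          subset_rfl⟩
        rintro z (rfl | rfl | rfl | hz)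
        exacts [hK.subset_ground he, hK.subset_ground he', hK.subset_ground he₀,
          hI.indep.subset_ground hz]
      have hz1 : F e e' = 0 := by
        by_contra hcon
        rcases h2 hcon with h | h | h
        exacts [hee' h, hne h.symm, hIK e' he' h]
      have hz2 : F e' e = 0 := by
        by_contra hcon
        rcases h2' hcon with h | h | h
        exacts [hee h, hne h, hIK e he h]
      obtain ⟨Z, hZ, hZ0, hZc, hZX, hZY, -⟩ := hO.isModOriented.strong_elimination h1
        (hO.neg_mem _ h1') hA (q := e₀)
        (h2.trans (by
          rw [Set.insert_comm]
          exact Set.insert_subset_insert (Set.subset_insert _ _)))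
        (by
          rw [support_neg_sign]
          refine h2'.trans ?_
          rw [Set.insert_comm]
          exact Set.subset_insert _ _)
        (fun h ↦ by
          have : e ∈ Function.support (F e) := h4
          rw [h] at this
          simp [hz2] at this) (by simp [h3]) (by simp [h3, h3'])
      have hZs : Function.support Z ⊆ insert e (insert e' I) := by
        intro z hz
        rcases hZc z with h | h | h
        · exact absurd h hz
        · have hz' : F e z ≠ 0 := h ▸ hz
          rcases h2 hz' with h | h | h
          · exact absurd (h ▸ hZ0) hz
          · exact Or.inl h
          · exact Or.inr (Or.inr h)
        · have hz' : F e' z ≠ 0 := by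
            have h' : Z z ≠ 0 := hz
            rw [h] at h'; simpa using h'
          rcases h2' hz' with h | h | h
          · exact absurd (h ▸ hZ0) hz
          · exact Or.inr (Or.inl h)
          · exact Or.inr (Or.inr h)
      have hZe : Z e = F e e := hZY e (by simp [hz2])
      have hZe' : Z e' = -F e' e' := hZX e' hz1
      rcases hO.eq_or_eq_neg_of_pair hK hI he he' hne hX hZ hXs hZs with rfl | rfl
      · rw [hZe, hZe']; revert h4 h4'; generalize F e e = x; generalize F e' e' = y
        revert x y; decide
      · simp only [Pi.neg_apply, hZe, hZe']
        revert h4 h4'; generalize F e e = x; generalize F e' e' = y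
        revert x y; decide

/-- If the relation failed after the exchange, the circuits for the old and new basis could be taken
equal at `e` and opposite at `e'`. Eliminating `e'` keeps `e` and leaves a circuit meeting `K` in
`e` alone, which is impossible. -/
theorem IsOriented.pairOrthogonal_exchange {O : SignedMatroid β} (hO : O.IsOriented)
    {K I : Set β} (hK : O.toMatroid.IsCocircuit K) {a b : β}
    (hI : O.toMatroid.IsBasis I (O.toMatroid.E \ K))
    (hI' : O.toMatroid.IsBasis (insert b (I \ {a})) (O.toMatroid.E \ K))
    (hb : b ∈ O.toMatroid.E \ K) {σ : β → SignType} (hσ : Function.support σ = K)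
    (h : O.PairOrthogonal K I σ) : O.PairOrthogonal K (insert b (I \ {a})) σ := by
  intro e he e' he' hne X' hX' hXs' hXe'
  have hIK : ∀ x ∈ K, x ∉ I := fun x hx hx' ↦ (hI.subset hx').2 hx
  have hIK' : ∀ x ∈ K, x ∉ insert b (I \ {a}) := fun x hx hx' ↦ (hI'.subset hx').2 hx
  obtain ⟨X, hX, hXs, hXe, hXe₂⟩ := hO.exists_pair hK hI he he' hne hXe'
  have hXe₂' : X' e' ≠ 0 := by
    obtain ⟨z, hzK, hze, hz⟩ := hO.exists_ne_zero_of_isCocircuit hK hX' he hXe'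
    rcases hXs' hz with h | h | h
    exacts [absurd h hze, h ▸ hz, absurd h (hIK' z hzK)]
  have hg := h e he e' he' hne X hX hXs (hXe ▸ hXe')
  have hσe : σ e ≠ 0 := by rwa [← hσ] at he
  have hσe' : σ e' ≠ 0 := by rwa [← hσ] at he'
  by_contra hcon
  have hopp : X' e' = -X e' := by
    rw [hXe] at hg
    revert hg hcon hXe' hXe₂ hXe₂' hσe hσe'
    generalize X' e = x; generalize X' e' = y; generalize X e' = z; generalize σ e = u
    generalize σ e' = v
    revert x y z u v; decide
  have hA : O.toMatroid.NullityLeTwo (insert b (insert e' (insert e I))) := by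
    refine ⟨?_, insert e I, b, e', (hK.exists_isCircuit_pair hI he he' hne).1, subset_rfl⟩
    rintro z (rfl | rfl | rfl | hz)
    exacts [hb.1, hK.subset_ground he', hK.subset_ground he, hI.indep.subset_ground hz]
  have hsX : Function.support X ⊆ insert b (insert e' (insert e I)) := by
    refine hXs.trans ?_
    rw [Set.insert_comm]
    exact Set.subset_insert _ _
  have hsX' : Function.support X' ⊆ insert b (insert e' (insert e I)) := by
    intro z hz
    rcases hXs' hz with h | h | h | h
    · simp [h]
    · simp [h]
    · simp [h]
    · simp [h.1]
  obtain ⟨Z, hZ, hZ0, hZc, -, -, hZe⟩ := hO.isModOriented.strong_elimination hX hX' hA hsX hsX'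
    (fun heq ↦ by
      rcases hO.eq_or_eq_neg X hX X' hX' heq.le with rfl | rfl
      · revert hopp hXe₂'; generalize X e' = x; revert x; decide
      · simp only [Pi.neg_apply] at hXe
        revert hXe hXe'; generalize X' e = x; revert x; decide) hXe₂ hopp
  have hZe1 : Z e ≠ 0 := by rw [hZe e hXe, hXe]; exact hXe'
  obtain ⟨z, hzK, hze, hz⟩ := hO.exists_ne_zero_of_isCocircuit hK hZ he hZe1
  have hzA : z ∈ insert b (insert e' (insert e I)) := by
    rcases hZc z with h | h | h
    · exact absurd h hz
    · exact hsX (by simpa [h] using hz)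
    · exact hsX' (by simpa [h] using hz)
  rcases hzA with h | h | h | h
  · exact hb.2 (h ▸ hzK)
  · exact hz (h ▸ hZ0)
  · exact hze h
  · exact hIK z hzK h

/-- A signing built from one basis of the hyperplane works for every basis by exchange. This settles
circuits meeting `K` in two elements; induction on the size of the intersection with `K` settles the
rest. -/
theorem IsOriented.exists_signing {O : SignedMatroid β} (hO : O.IsOriented) {K : Set β}
    (hK : O.toMatroid.IsCocircuit K) :
    ∃ σ : β → SignType, Function.support σ = K ∧ ∀ X ∈ O.circuits, Orthogonal X σ := by
  obtain ⟨I₀, hI₀⟩ := O.toMatroid.exists_isBasis (O.toMatroid.E \ K)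
  obtain ⟨σ, hσ, hσI₀⟩ := hO.exists_pairOrthogonal hK hI₀
  have hσI : ∀ I, O.toMatroid.IsBasis I (O.toMatroid.E \ K) → O.PairOrthogonal K I σ :=
    fun I hI ↦ hI₀.exchange_induction hO.finite (fun J ↦ O.PairOrthogonal K J σ)
      (fun J a b hJ hJ' hb h ↦ hO.pairOrthogonal_exchange hK hJ hJ' hb hσ h) hI hσI₀
  have hσK : ∀ e, e ∈ K ↔ σ e ≠ 0 := fun e ↦ by rw [← hσ]; rfl
  have key : ∀ n, ∀ X ∈ O.circuits, (Function.support X ∩ K).ncard ≤ n →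
      (∀ e, X e * σ e ≠ -1) → ∀ e, X e * σ e ≠ 1 := by
    intro n
    induction n with
    | zero =>
      intro X hX hn _ e he
      rw [Nat.le_zero, Set.ncard_eq_zero ((hO.finite.subset hK.subset_ground).subset
        Set.inter_subset_right)] at hn
      have : e ∈ Function.support X ∩ K :=
        ⟨fun h ↦ by simp [h] at he, (hσK e).2 fun h ↦ by simp [h] at he⟩
      rw [hn] at this
      exact this
    | succ n ih =>
      intro X hX hn hpos e₁ he₁
      have hXe₁ : X e₁ ≠ 0 := fun h ↦ by simp [h] at he₁
      have he₁K : e₁ ∈ K := (hσK _).2 fun h ↦ by simp [h] at he₁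
      obtain ⟨e₂, he₂K, hne, hXe₂⟩ := hO.exists_ne_zero_of_isCocircuit hK hX he₁K hXe₁
      have hcX := hO.isModOriented.isCircuit hX
      have hind : O.toMatroid.Indep (Function.support X \ K) :=
        hcX.ssubset_indep (ssubset_of_subset_of_ne Set.sdiff_subset
          fun h ↦ (h.symm ▸ hXe₁ : e₁ ∈ Function.support X \ K).2 he₁K)
      obtain ⟨I, hI, hXI⟩ := hind.subset_isBasis_of_subset (X := O.toMatroid.E \ K)
        (Set.sdiff_subset_sdiff_left hcX.subset_ground)
      -- Since `σ` is pair-orthogonal for a basis `I` containing `X \ K`, this `Y` agrees with `X`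
      -- at `e₁` and is opposite at `e₂`. Eliminating `e₂` gives `Z` with the signs of `X` on `K`
      -- and a smaller intersection with `K`.
      obtain ⟨Y, hY, hYs, hYe₂, hYe₁⟩ := hO.exists_pair hK hI he₂K he₁K hne (s := -X e₂)
        (by simpa using hXe₂)
      have hg := hσI I hI e₂ he₂K e₁ he₁K hne Y hY hYs (by rw [hYe₂]; simpa using hXe₂)
      have hσ₁ := (hσK _).1 he₁K
      have hσ₂ := (hσK _).1 he₂K
      have hYe₁' : Y e₁ = X e₁ := by
        have := hpos e₂
        rw [hYe₂] at hg
        revert hg this he₁ hσ₂ hXe₂ hYe₁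
        generalize X e₁ = x₁; generalize X e₂ = x₂; generalize Y e₁ = y₁
        generalize σ e₁ = s₁; generalize σ e₂ = s₂
        revert x₁ x₂ y₁ s₁ s₂; decide
      obtain ⟨Z, hZ, hZ0, hZc⟩ : ∃ Z ∈ O.circuits, Z e₂ = 0 ∧
          ∀ f, Z f = 0 ∨ Z f = X f ∨ Z f = Y f := by
        have h₁ : X ≠ -Y := fun h ↦ by
          rw [h, Pi.neg_apply] at hYe₁'
          revert hYe₁' hYe₁; generalize Y e₁ = x; revert x; decide
        have h₂ : Y ≠ -X := fun h ↦ h₁ (by rw [h, neg_neg])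
        rcases h : X e₂ with _ | _ | _
        · exact absurd h hXe₂
        · obtain ⟨Z, hZ, hZq, hp, hm⟩ := hO.elimination Y hY X hX h₂ e₂
            (by rw [hYe₂, h]; rfl) h
          exact ⟨Z, hZ, hZq, fun f ↦ by
            rcases eq_zero_or_of_signs (hp f) (hm f) with h | h | h <;> tauto⟩
        · obtain ⟨Z, hZ, hZq, hp, hm⟩ := hO.elimination X hX Y hY h₁ e₂ h
            (by rw [hYe₂, h]; rfl)
          exact ⟨Z, hZ, hZq, fun f ↦ eq_zero_or_of_signs (hp f) (hm f)⟩
      have hIK : ∀ x ∈ K, x ∉ I := fun x hx hx' ↦ (hI.subset hx').2 hx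
      have hYK : ∀ f ∈ K, Y f ≠ 0 → f = e₂ ∨ f = e₁ := by
        intro f hf hYf
        rcases hYs hYf with h | h | h
        exacts [Or.inl h, Or.inr h, absurd h (hIK f hf)]
      have hZK : ∀ f ∈ K, Z f ≠ 0 → Z f = X f := by
        intro f hf hZf
        rcases hZc f with h | h | h
        · exact absurd h hZf
        · exact h
        · rcases hYK f hf (h ▸ hZf) with rfl | rfl
          · exact absurd hZ0 hZf
          · rw [h, hYe₁']
      have hZσ : ∀ f, Z f * σ f = 0 ∨ Z f * σ f = X f * σ f := by
        intro f
        by_cases hf : f ∈ K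
        · by_cases hZf : Z f = 0
          · simp [hZf]
          · right; rw [hZK f hf hZf]
        · have : σ f = 0 := by by_contra h; exact hf ((hσK f).2 h)
          simp [this]
      have hZno := ih Z hZ (by
        have hss : Function.support Z ∩ K ⊂ Function.support X ∩ K := by
          refine ssubset_of_subset_of_ne ?_ fun h ↦
            (h ▸ ⟨hXe₂, he₂K⟩ : e₂ ∈ Function.support Z ∩ K).1 hZ0
          rintro f ⟨hf, hfK⟩
          exact ⟨fun h ↦ hf ((hZK f hfK hf).trans h), hfK⟩
        have := Set.ncard_lt_ncard hss ((hO.finite.subset hK.subset_ground).subset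
          Set.inter_subset_right)
        omega) (by
        intro f hf
        rcases hZσ f with h | h
        · rw [hf] at h; revert h; decide
        · exact hpos f (h ▸ hf))
      -- By induction `Z` has no element in `K`, so the circuit `Z` lies in the independent set `I`.
      refine (hO.isModOriented.isCircuit hZ).not_indep (hI.indep.subset fun f hf ↦ ?_)
      have hfK : f ∉ K := by
        intro hfK
        have h1 := hZno f
        have h2 := hpos f
        have h3 := hZK f hfK hf
        have h4 := (hσK f).1 hfK
        rw [h3] at h1
        have h5 : X f ≠ 0 := h3 ▸ hf
        revert h1 h2 h4 h5
        generalize X f = x; generalize σ f = y; revert x y; decide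
      rcases hZc f with h | h | h
      · exact absurd h hf
      · exact hXI ⟨fun h' ↦ hf (h.trans h'), hfK⟩
      · rcases hYs (fun h' ↦ hf (h.trans h') : f ∈ Function.support Y) with h | h | h
        exacts [absurd he₂K (h ▸ hfK), absurd he₁K (h ▸ hfK), h]
  refine ⟨σ, hσ, fun X hX ↦ ⟨fun ⟨e, he⟩ ↦ ?_, fun ⟨e, he⟩ ↦ ?_⟩⟩
  · by_contra! hcon
    exact key _ X hX le_rfl hcon e he
  · by_contra! hcon
    refine key _ (-X) (hO.neg_mem X hX) le_rfl (fun f hf ↦ hcon f ?_) e ?_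
    · simp only [Pi.neg_apply, neg_mul] at hf
      simpa using congrArg Neg.neg hf
    · simp [he]

end SignedMatroid

/-! ### Modular elimination for signed cocircuits. -/

namespace SignedMatroid

variable {β : Type*}

-- The hypotheses are the orthogonality of one circuit to `Y₁`, `Y₂`, `Z` read off at elements `s`,
-- `z`, `e`, with `Y₁`, `Y₂` opposite at `e`, `Y₁ z = 0`, `Y₂ s = 0` and `Z e = 0`; `d` and `f`
-- stand for `Y₂ z` and `Z z`.
set_option synthInstance.maxSize 4096 in
theorem sign_eq_of_opposite : ∀ a b g d f : SignType, d ≠ 0 →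
    (a = 1 ∨ (0 : SignType) = 1 ∨ g * 1 = 1 ↔ a = -1 ∨ (0 : SignType) = -1 ∨ g * 1 = -1) →
    ((0 : SignType) = 1 ∨ b * d = 1 ∨ g * -1 = 1 ↔ (0 : SignType) = -1 ∨ b * d = -1 ∨ g * -1 = -1) →
    (a = 1 ∨ b * f = 1 ∨ (0 : SignType) = 1 ↔ a = -1 ∨ b * f = -1 ∨ (0 : SignType) = -1) →
    a ≠ 0 ∨ b ≠ 0 ∨ g ≠ 0 → f = d := by
  decide

-- The same test at elements `s`, `t`, `z`, where `Y₁` and `Y₂` share the value `d` at `z`, `Y₁ t =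
-- 0`, `Y₂ s = 0`, and `f` stands for `Z z`.
set_option synthInstance.maxSize 4096 in
theorem sign_eq_of_agree : ∀ a b g d f : SignType, d ≠ 0 →
    (a = 1 ∨ (0 : SignType) = 1 ∨ g * d = 1 ↔ a = -1 ∨ (0 : SignType) = -1 ∨ g * d = -1) →
    ((0 : SignType) = 1 ∨ b = 1 ∨ g * d = 1 ↔ (0 : SignType) = -1 ∨ b = -1 ∨ g * d = -1) →
    (a = 1 ∨ b = 1 ∨ g * f = 1 ↔ a = -1 ∨ b = -1 ∨ g * f = -1) →
    a ≠ 0 ∨ b ≠ 0 ∨ g ≠ 0 → f = d := by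
  decide

theorem Orthogonal.neg_right {X Y : β → SignType} (h : Orthogonal X Y) : Orthogonal X (-Y) := by
  have h1 : ∀ e, X e * (-Y) e = 1 ↔ X e * Y e = -1 := by
    intro e; simp only [Pi.neg_apply]; generalize X e = x; generalize Y e = y; revert x y; decide
  have h2 : ∀ e, X e * (-Y) e = -1 ↔ X e * Y e = 1 := by
    intro e; simp only [Pi.neg_apply]; generalize X e = x; generalize Y e = y; revert x y; decide
  simp only [Orthogonal, h1, h2]
  exact h.symm

theorem Orthogonal.of_three {X Y : β → SignType} (h : Orthogonal X Y) {a b c : β}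
    (h0 : ∀ e, e ≠ a → e ≠ b → e ≠ c → X e * Y e = 0) :
    (X a * Y a = 1 ∨ X b * Y b = 1 ∨ X c * Y c = 1) ↔
      (X a * Y a = -1 ∨ X b * Y b = -1 ∨ X c * Y c = -1) := by
  have key : ∀ s : SignType, s ≠ 0 → ((∃ e, X e * Y e = s) ↔
      (X a * Y a = s ∨ X b * Y b = s ∨ X c * Y c = s)) := by
    intro s hs
    constructor
    · rintro ⟨e, he⟩
      by_cases ha : e = a
      · exact Or.inl (ha ▸ he)
      by_cases hb : e = b
      · exact Or.inr (Or.inl (hb ▸ he))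
      by_cases hc : e = c
      · exact Or.inr (Or.inr (hc ▸ he))
      exact absurd ((h0 e ha hb hc).symm.trans he).symm hs
    · rintro (h | h | h) <;> exact ⟨_, h⟩
  rw [← key 1 (by decide), ← key (-1) (by decide)]
  exact h

theorem dual_neg_mem {O : SignedMatroid β} {Y : β → SignType} (hY : Y ∈ O.dual.circuits) :
    -Y ∈ O.dual.circuits :=
  ⟨by rw [support_neg_sign]; exact hY.1, fun X hX ↦ (hY.2 X hX).neg_right⟩

/-- A circuit meeting the cocircuit in exactly `e` and `e₀` forces the product of the two signs, so
a single entry determines the signing. -/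
theorem IsOriented.dual_eq_or_eq_neg {O : SignedMatroid β} (hO : O.IsOriented)
    {Y Y' : β → SignType} (hY : Y ∈ O.dual.circuits) (hY' : Y' ∈ O.dual.circuits)
    (hs : Function.support Y ⊆ Function.support Y') : Y = Y' ∨ Y = -Y' := by
  have hK := hY.1
  have hsupp : Function.support Y = Function.support Y' :=
    Matroid.IsCircuit.eq_of_subset_isCircuit hY.1 hY'.1 hs
  obtain ⟨I, hI⟩ := O.toMatroid.exists_isBasis (O.toMatroid.E \ Function.support Y)
  obtain ⟨e₀, he₀⟩ := hK.nonempty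
  have hiff : ∀ e, Y e = 0 ↔ Y' e = 0 := fun e ↦ not_iff_not.1 (Set.ext_iff.1 hsupp e)
  have key : ∀ e, Y e * Y e₀ = Y' e * Y' e₀ := by
    intro e
    by_cases he : Y e = 0
    · simp [he, (hiff e).1 he]
    by_cases hee : e = e₀
    · subst hee
      have := mt (hiff e).2 he
      revert this he; generalize Y e = x; generalize Y' e = y; revert x y; decide
    obtain ⟨X, hX, hXs, hXe, hXe₀⟩ := hO.exists_pair hK hI he he₀ hee (s := 1) (by decide)
    have h0 : ∀ z, z ≠ e → z ≠ e₀ → Y z ≠ 0 → X z = 0 := by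
      intro z h1 h2 h3
      by_contra h4
      rcases hXs h4 with h | h | h
      exacts [h1 h, h2 h, (hI.subset h).2 h3]
    have h1 := (hY.2 X hX).of_three (a := e) (b := e₀) (c := e₀) (by
      intro z hz1 hz2 _
      by_cases hz : Y z = 0
      · simp [hz]
      · simp [h0 z hz1 hz2 hz])
    have h2 := (hY'.2 X hX).of_three (a := e) (b := e₀) (c := e₀) (by
      intro z hz1 hz2 _
      by_cases hz : Y z = 0
      · simp [(hiff z).1 hz]
      · simp [h0 z hz1 hz2 hz])
    have h3 := mt (hiff e).2 he
    have h4 : Y e₀ ≠ 0 := he₀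
    have h5 := mt (hiff e₀).2 h4
    rw [hXe] at h1 h2
    clear hXs hX hXe h0
    revert he h1 h2 h3 h4 h5 hXe₀
    generalize Y e = y; generalize Y e₀ = y₀; generalize Y' e = y'; generalize Y' e₀ = y₀'
    generalize X e₀ = x
    revert y y₀ y' y₀' x; decide
  have h4 : Y e₀ ≠ 0 := he₀
  have h5 := mt (hiff e₀).2 h4
  by_cases h : Y e₀ = Y' e₀
  · left
    ext e
    have := key e
    rw [← h] at this
    have h6 := hiff e
    revert this h4 h6
    generalize Y e = y; generalize Y e₀ = y₀; generalize Y' e = y'; revert y y₀ y'; decide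
  · right
    ext e
    have := key e
    have h' : Y' e₀ = -Y e₀ := by
      revert h h4 h5; generalize Y e₀ = y₀; generalize Y' e₀ = y₀'; revert y₀ y₀'; decide
    rw [h'] at this
    have h6 := hiff e
    simp only [Pi.neg_apply]
    revert this h4 h6
    generalize Y e = y; generalize Y e₀ = y₀; generalize Y' e = y'; revert y y₀ y'; decide

/-- For elimination, the underlying matroid supplies a cocircuit inside `A \ {e}`. Once its signing
is normalised at some `s` in `Y₁` outside `Y₂`, circuits meeting `A` in at most three elements force
every entry except where `Y₁` and `Y₂` are opposite. Such circuits exist because the pair is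
modular. -/
theorem IsOriented.dual_isModOriented {O : SignedMatroid β} (hO : O.IsOriented) :
    O.dual.IsModOriented where
  finite := hO.finite
  isCircuit_iff C := by
    constructor
    · intro hC
      obtain ⟨σ, hσ, hσX⟩ := hO.exists_signing hC
      exact ⟨σ, ⟨hσ.symm ▸ hC, hσX⟩, hσ⟩
    · rintro ⟨σ, hσ, rfl⟩
      exact hσ.1
  neg_mem Y hY := dual_neg_mem hY
  eq_or_eq_neg Y hY Y' hY' hs := hO.dual_eq_or_eq_neg hY hY' hs
  elimination := by
    intro Y₁ hY₁ Y₂ hY₂ hN hne e he₁ he₂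
    set A := Function.support Y₁ ∪ Function.support Y₂ with hAdef
    have hsne : Function.support Y₁ ≠ Function.support Y₂ := by
      intro hs
      rcases hO.dual_eq_or_eq_neg hY₁ hY₂ hs.le with h | h
      · rw [h, he₂] at he₁; revert he₁; decide
      · exact hne h
    have hmem : ∀ z, z ∈ A ↔ Y₁ z ≠ 0 ∨ Y₂ z ≠ 0 := fun z ↦ Iff.rfl
    obtain ⟨s, hs₁, hs₂⟩ : ∃ s, Y₁ s ≠ 0 ∧ Y₂ s = 0 := by
      by_contra! hcon
      exact hsne (Matroid.IsCircuit.eq_of_subset_isCircuit hY₁.1 hY₂.1 hcon)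
    obtain ⟨C, hCs, hC⟩ := Matroid.IsCircuit.elimination hY₁.1 hY₂.1 hsne e
    obtain ⟨Z₀, hZ₀, hZ₀X⟩ := hO.exists_signing hC
    have htriple : ∀ a ∈ A, ∀ b ∈ A, ∀ c ∈ A, a ≠ b → a ≠ c → b ≠ c → ∃ X ∈ O.circuits,
        (X a ≠ 0 ∨ X b ≠ 0 ∨ X c ≠ 0) ∧
        ∀ Y : β → SignType, Function.support Y ⊆ A → (∀ X ∈ O.circuits, Orthogonal X Y) →
        ((X a * Y a = 1 ∨ X b * Y b = 1 ∨ X c * Y c = 1) ↔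
          (X a * Y a = -1 ∨ X b * Y b = -1 ∨ X c * Y c = -1)) := by
      intro a ha b hb c hc hab hac hbc
      obtain ⟨C, hC, hC1, hC2⟩ :=
        Matroid.exists_isCircuit_subset_triple hO.finite hN ha hb hc hab hac hbc
      obtain ⟨X, hX, rfl⟩ := (hO.isCircuit_iff C).1 hC
      refine ⟨X, hX, hC1, fun Y hYA hY ↦ (hY X hX).of_three fun z h1 h2 h3 ↦ ?_⟩
      by_cases hYz : Y z = 0
      · simp [hYz]
      · by_cases hXz : X z = 0
        · simp [hXz]
        · rcases hC2 z (hYA hYz) hXz with h | h | h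
          exacts [absurd h h1, absurd h h2, absurd h h3]
    have hY₁A : Function.support Y₁ ⊆ A := Set.subset_union_left
    have hY₂A : Function.support Y₂ ⊆ A := Set.subset_union_right
    have hZ₀A : Function.support Z₀ ⊆ A := hZ₀ ▸ hCs.trans Set.sdiff_subset
    have hZ₀e : Z₀ e = 0 := by
      by_contra h
      exact (hCs (hZ₀ ▸ h : e ∈ C)).2 rfl
    have he₁' : Y₁ e ≠ 0 := by rw [he₁]; decide
    have he₂' : Y₂ e ≠ 0 := by rw [he₂]; decide
    have heA : e ∈ A := hY₁A he₁'
    have hsA : s ∈ A := hY₁A hs₁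
    have hse : s ≠ e := fun h ↦ he₂' (h ▸ hs₂)
    -- If `Z₀` vanished at `s` as well as at `e`, a circuit on `s`, `z`, `e` would vanish at `z` by
    -- `Z₀`, then at `e` by `Y₂`, then at `s` by `Y₁`.
    have hZ₀s : Z₀ s ≠ 0 := by
      intro hcon
      obtain ⟨z, hz⟩ := hC.nonempty
      have hz' : Z₀ z ≠ 0 := by rwa [← hZ₀] at hz
      have hzs : s ≠ z := fun h ↦ hz' (h ▸ hcon)
      have hze : z ≠ e := fun h ↦ hz' (h ▸ hZ₀e)
      obtain ⟨X, hX, hX0, hXo⟩ := htriple s hsA z (hZ₀A hz') e heA hzs hse hze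
      have h1 := hXo Y₁ hY₁A hY₁.2
      have h2 := hXo Y₂ hY₂A hY₂.2
      have h3 := hXo Z₀ hZ₀A hZ₀X
      have hXz : X z = 0 := by
        rw [hcon, hZ₀e] at h3
        revert h3 hz'; clear * -; generalize X z = x; generalize Z₀ z = y; revert x y; simp; decide
      have hXe : X e = 0 := by
        rw [hXz, hs₂] at h2
        revert h2 he₂'; clear * -; generalize X e = x; generalize Y₂ e = y; revert x y; simp; decide
      have hXs : X s = 0 := by
        rw [hXz, hXe] at h1
        revert h1 hs₁; clear * -; generalize X s = x; generalize Y₁ s = y; revert x y; simp; decide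
      simp [hXz, hXe, hXs] at hX0
    obtain ⟨Z, hZ, hZA, hZe, hZs⟩ : ∃ Z ∈ O.dual.circuits, Function.support Z ⊆ A ∧ Z e = 0 ∧
        Z s = Y₁ s := by
      have hZd : Z₀ ∈ O.dual.circuits := ⟨hZ₀.symm ▸ hC, hZ₀X⟩
      by_cases h : Z₀ s = Y₁ s
      · exact ⟨Z₀, hZd, hZ₀A, hZ₀e, h⟩
      · refine ⟨-Z₀, dual_neg_mem hZd, by rwa [support_neg_sign], by simp [hZ₀e], ?_⟩
        simp only [Pi.neg_apply]
        revert h hZ₀s hs₁; clear * -; generalize Z₀ s = x; generalize Y₁ s = y; revert x y; decide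
    have hZX := hZ.2
    have h12 : ∀ z, Y₁ z ≠ 0 → Y₂ z = 0 → Z z = Y₁ z := by
      intro z hz₁ hz₂
      by_cases hsz : s = z
      · exact hsz ▸ hZs
      have hze : z ≠ e := fun h ↦ he₂' (h ▸ hz₂)
      obtain ⟨X, hX, hX0, hXo⟩ := htriple s hsA z (hY₁A hz₁) e heA hsz hse hze
      have h1 := hXo Y₁ hY₁A hY₁.2
      have h2 := hXo Y₂ hY₂A hY₂.2
      have h3 := hXo Z hZA hZX
      have hXe : X e = 0 := by
        rw [hz₂, hs₂] at h2
        revert h2 he₂'; clear * -; generalize X e = x; generalize Y₂ e = y; revert x y; simp; decide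
      rw [hXe] at h1 h3 hX0
      rw [hZs] at h3
      revert h1 h3 hX0 hz₁ hs₁
      clear * -
      generalize X s = a; generalize X z = b; generalize Y₁ s = c; generalize Y₁ z = d
      generalize Z z = f; simp; revert a b c d f; decide
    have h21 : ∀ z, Y₁ z = 0 → Y₂ z ≠ 0 → Z z = Y₂ z := by
      intro z hz₁ hz₂
      have hsz : s ≠ z := fun h ↦ hs₁ (h ▸ hz₁)
      have hze : z ≠ e := fun h ↦ he₁' (h ▸ hz₁)
      obtain ⟨X, hX, hX0, hXo⟩ := htriple s hsA z (hY₂A hz₂) e heA hsz hse hze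
      have h1 := hXo Y₁ hY₁A hY₁.2
      have h2 := hXo Y₂ hY₂A hY₂.2
      have h3 := hXo Z hZA hZX
      rw [hz₁, he₁] at h1
      rw [hs₂, he₂] at h2
      rw [hZe, hZs] at h3
      have hX0' : X s * Y₁ s ≠ 0 ∨ X z ≠ 0 ∨ X e ≠ 0 :=
        hX0.imp_left fun h ↦ mul_ne_zero h hs₁
      simp only [mul_zero] at h1 h2 h3
      exact sign_eq_of_opposite _ _ _ _ _ hz₂ h1 h2 h3 hX0'
    obtain ⟨t, ht₁, ht₂⟩ : ∃ t, Y₁ t = 0 ∧ Y₂ t ≠ 0 := by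
      by_contra! hcon
      exact hsne (Matroid.IsCircuit.eq_of_superset_isCircuit hY₁.1 hY₂.1
        fun z hz ↦ fun h ↦ hz (hcon z h))
    refine ⟨Z, hZ, hZe, fun z ↦ ?_⟩
    by_cases hz₁ : Y₁ z = 0
    · by_cases hz₂ : Y₂ z = 0
      · left
        by_contra h
        rcases hZA h with h | h
        exacts [h hz₁, h hz₂]
      · exact Or.inr (Or.inr (h21 z hz₁ hz₂))
    by_cases hz₂ : Y₂ z = 0
    · exact Or.inr (Or.inl (h12 z hz₁ hz₂))
    by_cases heq : Y₁ z = Y₂ z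
    · have hsz : s ≠ z := fun h ↦ hz₂ (h ▸ hs₂)
      have htz : t ≠ z := fun h ↦ hz₁ (h ▸ ht₁)
      have hst : s ≠ t := fun h ↦ hs₁ (h ▸ ht₁)
      obtain ⟨X, hX, hX0, hXo⟩ := htriple s hsA t (hY₂A ht₂) z (hY₁A hz₁) hst hsz htz
      have h1 := hXo Y₁ hY₁A hY₁.2
      have h2 := hXo Y₂ hY₂A hY₂.2
      have h3 := hXo Z hZA hZX
      rw [ht₁] at h1
      rw [hs₂, ← heq] at h2
      rw [hZs, h21 t ht₁ ht₂] at h3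
      right; left
      have hX0' : X s * Y₁ s ≠ 0 ∨ X t * Y₂ t ≠ 0 ∨ X z ≠ 0 :=
        hX0.imp (fun h ↦ mul_ne_zero h hs₁) (Or.imp_left fun h ↦ mul_ne_zero h ht₂)
      simp only [mul_zero] at h1 h2 h3
      exact sign_eq_of_agree _ _ _ _ _ hz₁ h1 h2 h3 hX0'
    -- Here `Y₁ z` and `Y₂ z` are nonzero and opposite, so every sign is allowed at `z`.
    · revert heq hz₁ hz₂
      clear * -
      generalize Y₁ z = a; generalize Y₂ z = b; generalize Z z = c; revert a b c; decide

end SignedMatroid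

/-! ### Transversal presentations by edges with at most two ends. -/

namespace Matroid

variable {β W : Type*}

/-- The members of `I` have distinct representatives in the sets `ends e`. -/
def HasSDR (ends : β → Finset W) (I : Set β) : Prop :=
  ∃ φ : β → W, Set.InjOn φ I ∧ ∀ e ∈ I, φ e ∈ ends e

/-- `M` is the transversal matroid of a family of sets such that every element is in at most two
members of the family; the elements of `ends e` are the indices of these members. -/
structure IsPresentedBy (M : Matroid β) (ends : β → Finset W) : Prop where
  card_le : ∀ e, (ends e).card ≤ 2
  indep_iff : ∀ I ⊆ M.E, M.Indep I ↔ HasSDR ends I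

theorem HasSDR.mono {ends : β → Finset W} {I J : Set β} (h : HasSDR ends I) (hJI : J ⊆ I) :
    HasSDR ends J := by
  obtain ⟨φ, h1, h2⟩ := h
  exact ⟨φ, h1.mono hJI, fun e he ↦ h2 e (hJI he)⟩

theorem hasSDR_iff [DecidableEq W] [Nonempty W] {ends : β → Finset W} {I : Set β} :
    HasSDR ends I ↔ ∀ J : Finset β, (J : Set β) ⊆ I → J.card ≤ (J.biUnion ends).card := by
  classical
  constructor
  · rintro ⟨φ, h1, h2⟩ J hJ
    refine Finset.card_le_card_of_injOn φ ?_ (h1.mono hJ)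
    intro e he
    exact Finset.mem_coe.2 (Finset.mem_biUnion.2 ⟨e, he, h2 e (hJ he)⟩)
  · intro h
    obtain ⟨φ, hφ, hφm⟩ :=
      (Finset.all_card_le_biUnion_card_iff_exists_injective (fun e : I ↦ ends e)).1 (by
        intro s
        have := h (s.map (Function.Embedding.subtype _)) (by
          intro e he
          simp only [Finset.coe_map, Set.mem_image] at he
          obtain ⟨x, -, rfl⟩ := he
          exact x.2)
        rw [Finset.card_map] at this
        refine this.trans (Finset.card_le_card ?_)
        intro w hw
        simp only [Finset.mem_biUnion, Finset.mem_map] at hw ⊢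
        obtain ⟨e, ⟨x, hx, rfl⟩, hw⟩ := hw
        exact ⟨x, hx, hw⟩)
    refine ⟨fun e ↦ if h : e ∈ I then φ ⟨e, h⟩ else Classical.arbitrary W, ?_, ?_⟩
    · intro a ha b hb hab
      simp only [ha, hb, dif_pos] at hab
      exact congrArg Subtype.val (hφ hab)
    · intro e he
      simp only [he, dif_pos]
      exact hφm ⟨e, he⟩

theorem IsPresentedBy.delete {M : Matroid β} {ends : β → Finset W} (h : M.IsPresentedBy ends)
    (D : Set β) : (M.delete D).IsPresentedBy ends where
  card_le := h.card_le
  indep_iff I hI := by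
    rw [delete_ground, Set.subset_sdiff] at hI
    rw [delete_indep_iff, h.indep_iff I hI.1, and_iff_left hI.2]

theorem IsPresentedBy.isLoop_of_ends_eq_empty {M : Matroid β} {ends : β → Finset W}
    (h : M.IsPresentedBy ends) {e : β} (he : e ∈ M.E) (he0 : ends e = ∅) : M.IsLoop e := by
  rw [← singleton_dep, Dep, and_iff_left (Set.singleton_subset_iff.2 he),
    h.indep_iff _ (Set.singleton_subset_iff.2 he)]
  rintro ⟨φ, -, hφ⟩
  simpa [he0] using hφ e rfl

/-- In a system of representatives for `I ∪ {e}`, the edge `e` uses up one of its ends. If it has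
the single end `u`, then `u` is lost to all other edges; if it has ends `u` and `v`, one of them
remains, which amounts to identifying them. Edges may end up with no ends, and these are loops of
the matroid. -/
theorem IsPresentedBy.exists_contractElem {M : Matroid β} {ends : β → Finset W}
    (h : M.IsPresentedBy ends) (e : β) :
    ∃ ends' : β → Finset W, (M.contract {e}).IsPresentedBy ends' := by
  classical
  by_cases heE : e ∉ M.E
  · exact ⟨ends, by rwa [contractElem_eq_self heE]⟩
  push Not at heE
  rcases Finset.eq_empty_or_nonempty (ends e) with he0 | hen
  · refine ⟨ends, ?_⟩
    rw [contract_eq_delete_of_subset_loops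
      (Set.singleton_subset_iff.2 (h.isLoop_of_ends_eq_empty heE he0))]
    exact h.delete _
  have hind : M.Indep {e} := by
    obtain ⟨w, hw⟩ := hen
    rw [h.indep_iff _ (Set.singleton_subset_iff.2 heE)]
    exact ⟨fun _ ↦ w, by simp, by simpa using hw⟩
  have hiff : ∀ I ⊆ (M.contract {e}).E, ((M.contract {e}).Indep I ↔ HasSDR ends (insert e I)) := by
    intro I hI
    rw [contract_ground, Set.subset_sdiff] at hI
    rw [hind.contract_indep_iff, and_iff_right hI.2, Set.union_singleton,
      h.indep_iff _ (Set.insert_subset heE hI.1)]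
  have heI : ∀ I ⊆ (M.contract {e}).E, e ∉ I := fun I hI he ↦ by simpa using hI he
  obtain ⟨u, v, huv⟩ : ∃ u v, ends e = {u, v} := by
    have h1 := h.card_le e
    have h2 := hen.card_pos
    interval_cases hc : (ends e).card
    · obtain ⟨u, hu⟩ := Finset.card_eq_one.1 hc
      exact ⟨u, u, by simp [hu]⟩
    · obtain ⟨u, v, -, huv⟩ := Finset.card_eq_two.1 hc
      exact ⟨u, v, huv⟩
  by_cases huv' : u = v
  · subst huv'
    refine ⟨fun f ↦ (ends f).erase u, fun f ↦ (Finset.card_erase_le).trans (h.card_le f), ?_⟩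
    intro I hI
    rw [hiff I hI]
    constructor
    · rintro ⟨φ, h1, h2⟩
      have hφe : φ e = u := by simpa [huv] using h2 e (Set.mem_insert e I)
      refine ⟨φ, h1.mono (Set.subset_insert e I), fun f hf ↦ Finset.mem_erase.2 ⟨fun hfu ↦ ?_,
        h2 f (Or.inr hf)⟩⟩
      exact heI I hI (h1 (Or.inr hf) (Or.inl rfl) (hfu.trans hφe.symm) ▸ hf)
    · rintro ⟨φ, h1, h2⟩
      have hne : ∀ f ∈ I, f ≠ e := fun f hf hfe ↦ heI I hI (hfe ▸ hf)
      refine ⟨Function.update φ e u, ?_, ?_⟩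
      · rw [Set.injOn_insert (heI I hI)]
        refine ⟨fun a ha b hb hab ↦ ?_, ?_⟩
        · rw [Function.update_of_ne (hne a ha), Function.update_of_ne (hne b hb)] at hab
          exact h1 ha hb hab
        · rintro ⟨f, hf, hfe⟩
          rw [Function.update_of_ne (hne f hf), Function.update_self] at hfe
          exact (Finset.mem_erase.1 (h2 f hf)).1 hfe
      · rintro f (rfl | hf)
        · simp [huv]
        · rw [Function.update_of_ne (hne f hf)]
          exact (Finset.mem_erase.1 (h2 f hf)).2
  · set g : W → W := Function.update id v u with hg
    have hgv : g v = u := by simp [hg]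
    have hgo : ∀ w, w ≠ v → g w = w := fun w hw ↦ by simp [hg, hw]
    have hgeq : ∀ a b, g a = g b → a = b ∨ (a = u ∧ b = v) ∨ (a = v ∧ b = u) := by
      intro a b hab
      by_cases ha : a = v <;> by_cases hb : b = v
      · exact Or.inl (ha.trans hb.symm)
      · rw [ha, hgv, hgo b hb] at hab
        exact Or.inr (Or.inr ⟨ha, hab.symm⟩)
      · rw [hb, hgv, hgo a ha] at hab
        exact Or.inr (Or.inl ⟨hab, hb⟩)
      · rw [hgo a ha, hgo b hb] at hab
        exact Or.inl hab
    refine ⟨fun f ↦ (ends f).image g, fun f ↦ (Finset.card_image_le).trans (h.card_le f), ?_⟩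
    intro I hI
    rw [hiff I hI]
    have hne : ∀ f ∈ I, f ≠ e := fun f hf hfe ↦ heI I hI (hfe ▸ hf)
    constructor
    · rintro ⟨φ, h1, h2⟩
      have hφe : φ e = u ∨ φ e = v := by simpa [huv] using h2 e (Set.mem_insert e I)
      refine ⟨g ∘ φ, fun a ha b hb hab ↦ ?_, fun f hf ↦
        Finset.mem_image_of_mem g (h2 f (Or.inr hf))⟩
      have hkey : ∀ f ∈ I, φ f ≠ φ e := fun f hf hfe ↦
        hne f hf (h1 (Or.inr hf) (Or.inl rfl) hfe)
      rcases hgeq _ _ hab with h' | ⟨h3, h4⟩ | ⟨h3, h4⟩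
      · exact h1 (Or.inr ha) (Or.inr hb) h'
      · rcases hφe with h5 | h5
        exacts [absurd (h3.trans h5.symm) (hkey a ha), absurd (h4.trans h5.symm) (hkey b hb)]
      · rcases hφe with h5 | h5
        exacts [absurd (h4.trans h5.symm) (hkey b hb), absurd (h3.trans h5.symm) (hkey a ha)]
    · rintro ⟨φ, h1, h2⟩
      have hch : ∀ f, ∃ w, f ∈ I → w ∈ ends f ∧ g w = φ f := by
        intro f
        by_cases hf : f ∈ I
        · obtain ⟨w, hw⟩ := Finset.mem_image.1 (h2 f hf)
          exact ⟨w, fun _ ↦ hw⟩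
        · exact ⟨u, fun h ↦ absurd h hf⟩
      choose ψ hψ using hch
      have hinj : Set.InjOn ψ I := fun a ha b hb hab ↦
        h1 ha hb (by rw [← (hψ a ha).2, ← (hψ b hb).2, hab])
      -- Because `g` merges `u` and `v`, the lifted representatives use at most one of them; the
      -- free one represents `e`.
      obtain ⟨w, hw, hwI⟩ : ∃ w ∈ ends e, ∀ f ∈ I, ψ f ≠ w := by
        by_contra! hcon
        obtain ⟨f, hf, hfu⟩ := hcon u (by simp [huv])
        obtain ⟨f', hf', hfv⟩ := hcon v (by simp [huv])
        have : f = f' := h1 hf hf' (by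
          rw [← (hψ f hf).2, ← (hψ f' hf').2, hfu, hfv, hgv, hgo u huv'])
        exact huv' (by rw [← hfu, ← hfv, this])
      refine ⟨Function.update ψ e w, ?_, ?_⟩
      · rw [Set.injOn_insert (heI I hI)]
        refine ⟨fun a ha b hb hab ↦ ?_, ?_⟩
        · rw [Function.update_of_ne (hne a ha), Function.update_of_ne (hne b hb)] at hab
          exact hinj ha hb hab
        · rintro ⟨f, hf, hfe⟩
          rw [Function.update_of_ne (hne f hf), Function.update_self] at hfe
          exact hwI f hf hfe
      · rintro f (rfl | hf)
        · simpa using hw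
        · rw [Function.update_of_ne (hne f hf)]
          exact (hψ f hf).1

theorem IsPresentedBy.exists_contract {M : Matroid β} {ends : β → Finset W}
    (h : M.IsPresentedBy ends) (hfin : M.E.Finite) (A : Set β) :
    ∃ ends' : β → Finset W, (M.contract A).IsPresentedBy ends' := by
  rw [← contract_inter_ground_eq]
  have hA : (A ∩ M.E).Finite := hfin.subset Set.inter_subset_right
  generalize A ∩ M.E = B at hA
  induction B, hA using Set.Finite.induction_on with
  | empty => exact ⟨ends, by simpa using h⟩
  | insert _ _ ih =>
    obtain ⟨ends', h'⟩ := ih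
    obtain ⟨ends'', h''⟩ := h'.exists_contractElem _
    refine ⟨ends'', ?_⟩
    rw [contract_contract, Set.union_singleton] at h''
    exact h''

/-- `C` is tight for Hall's condition and its proper nonempty subsets have a surplus, so the only
violator inside `C ∪ {f}` is the whole set. -/
theorem IsPresentedBy.isCircuit_insert [DecidableEq W] [DecidableEq β] [Nonempty W]
    {M : Matroid β} {ends : β → Finset W} (h : M.IsPresentedBy ends) {C : Finset β} {f : β}
    (hCE : (C : Set β) ⊆ M.E) (hfE : f ∈ M.E) (hfC : f ∉ C) (hf : (ends f).Nonempty)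
    (hfs : ends f ⊆ C.biUnion ends) (hC : (C.biUnion ends).card = C.card)
    (hlt : ∀ L ⊆ C, L.Nonempty → L ≠ C → L.card < (L.biUnion ends).card) :
    M.IsCircuit (insert f (C : Set β)) := by
  have hE : insert f (C : Set β) ⊆ M.E := Set.insert_subset hfE hCE
  rw [isCircuit_iff, Dep, and_iff_left hE, h.indep_iff _ hE, hasSDR_iff]
  constructor
  · intro hcon
    have := hcon (insert f C) (by simp)
    rw [Finset.card_insert_of_notMem hfC, Finset.biUnion_insert,
      Finset.union_eq_right.2 hfs] at this
    omega
  · intro D hD hDs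
    have hDn := hD.not_indep
    rw [h.indep_iff _ hD.subset_ground, hasSDR_iff] at hDn
    push Not at hDn
    obtain ⟨J, hJD, hJ⟩ := hDn
    have hJs : J ⊆ insert f C := by
      intro e he
      have := hDs (hJD he)
      simpa using this
    have hLC : J.erase f ⊆ C := by
      intro e he
      have h1 := Finset.mem_erase.1 he
      exact (Finset.mem_insert.1 (hJs h1.2)).resolve_left h1.1
    have hmono : ((J.erase f).biUnion ends).card ≤ (J.biUnion ends).card :=
      Finset.card_le_card (Finset.biUnion_subset_biUnion_of_subset_left _ (Finset.erase_subset _ _))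
    have hc1 := Finset.pred_card_le_card_erase (s := J) (a := f)
    by_cases hLe : J.erase f = ∅
    · exfalso
      by_cases hfJ : f ∈ J
      · have : J = {f} := by
          rw [← Finset.insert_erase hfJ, hLe, insert_empty_eq]
        rw [this] at hJ
        simp only [Finset.singleton_biUnion, Finset.card_singleton] at hJ
        have := hf.card_pos
        omega
      · rw [Finset.erase_eq_of_notMem hfJ] at hLe
        simp [hLe] at hJ
    by_cases hLC' : J.erase f = C
    · by_cases hfJ : f ∈ J
      · refine hDs.antisymm ?_
        rw [← Finset.coe_insert, ← hLC', Finset.insert_erase hfJ]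
        exact hJD
      · rw [Finset.erase_eq_of_notMem hfJ] at hLC'
        rw [hLC'] at hJ
        omega
    · have := hlt _ hLC (Finset.nonempty_iff_ne_empty.2 hLe) hLC'
      omega

/-- A base avoiding every edge at `x` could be enlarged by `e`, represented by `x`. Hence the edges
at `x` contain a cocircuit, and cosimplicity bounds its size. -/
theorem IsPresentedBy.three_le_encard {M : Matroid β} {ends : β → Finset W}
    (h : M.IsPresentedBy ends) (hM : M.IsCosimple) {e : β} (heE : e ∈ M.E) {x : W}
    (hx : x ∈ ends e) : 3 ≤ {f ∈ M.E | x ∈ ends f}.encard := by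
  classical
  set S := {f ∈ M.E | x ∈ ends f} with hS
  have hSE : S ⊆ M.E := Set.sep_subset _ _
  have hd : M✶.Dep S := by
    refine ⟨fun hcon ↦ ?_, hSE⟩
    obtain ⟨B, hB, hBS⟩ := (dual_indep_iff_exists'.1 hcon).2
    obtain ⟨φ, h1, h2⟩ := (h.indep_iff B hB.subset_ground).1 hB.indep
    have heS : e ∈ S := ⟨heE, hx⟩
    have heB : e ∉ B := fun heB ↦ Set.disjoint_left.1 hBS heS heB
    have hBx : ∀ f ∈ B, φ f ≠ x := by
      intro f hf hfx
      exact Set.disjoint_left.1 hBS ⟨hB.subset_ground hf, hfx ▸ h2 f hf⟩ hf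
    have hne : ∀ f ∈ B, f ≠ e := fun f hf hfe ↦ heB (hfe ▸ hf)
    have : M.Indep (insert e B) := by
      rw [h.indep_iff _ (Set.insert_subset heE hB.subset_ground)]
      refine ⟨Function.update φ e x, ?_, ?_⟩
      · rw [Set.injOn_insert heB]
        refine ⟨fun a ha b hb hab ↦ ?_, ?_⟩
        · rw [Function.update_of_ne (hne a ha), Function.update_of_ne (hne b hb)] at hab
          exact h1 ha hb hab
        · rintro ⟨f, hf, hfe⟩
          rw [Function.update_of_ne (hne f hf), Function.update_self] at hfe
          exact hBx f hf hfe
      · rintro f (rfl | hf)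
        · simpa using hx
        · rw [Function.update_of_ne (hne f hf)]
          exact h2 f hf
    exact heB (hB.eq_of_subset_indep this (Set.subset_insert e B) ▸ Set.mem_insert e B)
  obtain ⟨C, hCS, hC⟩ := hd.exists_isCircuit_subset
  exact (hM C hC).trans (Set.encard_le_encard hCS)

/-- Swapping `f` and `p` preserves independence. By cosimplicity some base avoids both; the
fundamental circuit of `f` then avoids `p`, and the swap turns it into the second circuit. -/
theorem IsPresentedBy.exists_exchange_of_ends_eq {M : Matroid β} {ends : β → Finset W}
    (h : M.IsPresentedBy ends) (hM : M.IsCosimple) {f p : β} (hf : f ∈ M.E) (hp : p ∈ M.E)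
    (hfp : f ≠ p) (hends : ends f = ends p) :
    ∃ D, f ∉ D ∧ p ∉ D ∧ M.IsCircuit (insert f D) ∧ M.IsCircuit (insert p D) := by
  classical
  have hsw : ∀ f ∈ M.E, ∀ p ∈ M.E, ends f = ends p → ∀ S ⊆ M.E, f ∉ S → p ∉ S →
      M.Indep (insert f S) → M.Indep (insert p S) := by
    intro f hf p hp hends S hS hfS hpS hI
    rw [h.indep_iff _ (Set.insert_subset hp hS)]
    obtain ⟨φ, h1, h2⟩ := (h.indep_iff _ (Set.insert_subset hf hS)).1 hI
    have hne : ∀ e ∈ S, e ≠ p := fun e he hep ↦ hpS (hep ▸ he)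
    rw [Set.injOn_insert hfS] at h1
    refine ⟨Function.update φ p (φ f), ?_, ?_⟩
    · rw [Set.injOn_insert hpS]
      refine ⟨fun a ha b hb hab ↦ ?_, ?_⟩
      · rw [Function.update_of_ne (hne a ha), Function.update_of_ne (hne b hb)] at hab
        exact h1.1 ha hb hab
      · rintro ⟨e, he, hee⟩
        rw [Function.update_of_ne (hne e he), Function.update_self] at hee
        exact h1.2 ⟨e, he, hee⟩
    · rintro e (rfl | he)
      · simpa [← hends] using h2 f (Or.inl rfl)
      · rw [Function.update_of_ne (hne e he)]
        exact h2 e (Or.inr he)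
  have hco : M✶.Indep {f, p} := by
    by_contra hcon
    have hd : M✶.Dep {f, p} := ⟨hcon, by rintro z (rfl | rfl) <;> assumption⟩
    obtain ⟨C, hCs, hC⟩ := hd.exists_isCircuit_subset
    have h1 := (hM C hC).trans (Set.encard_le_encard hCs)
    rw [Set.encard_pair hfp] at h1
    exact absurd h1 (by norm_num)
  obtain ⟨B, hB, hBd⟩ := (dual_indep_iff_exists'.1 hco).2
  have hfB : f ∉ B := Set.disjoint_left.1 hBd (by simp)
  have hpB : p ∉ B := Set.disjoint_left.1 hBd (by simp)
  have hC := hB.fundCircuit_isCircuit hf hfB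
  have hfC := M.mem_fundCircuit f B
  have hCs := M.fundCircuit_subset_insert f B
  set C := M.fundCircuit f B
  have hpC : p ∉ C := by
    intro hpC
    rcases hCs hpC with h' | h'
    exacts [hfp h'.symm, hpB h']
  have hDE : C \ {f} ⊆ M.E := Set.sdiff_subset.trans hC.subset_ground
  have hfD : f ∉ C \ {f} := fun h ↦ h.2 rfl
  have hpD : p ∉ C \ {f} := fun h ↦ hpC h.1
  have hins : insert f (C \ {f}) = C := by
    rw [Set.insert_sdiff_singleton, Set.insert_eq_of_mem hfC]
  have hDind := hC.sdiff_singleton_indep hfC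
  refine ⟨C \ {f}, hfD, hpD, by rwa [hins], ?_⟩
  have hdep : M.Dep (insert p (C \ {f})) := by
    refine ⟨fun hI ↦ ?_, Set.insert_subset hp hDE⟩
    have := hsw p hp f hf hends.symm _ hDE hpD hfD hI
    rw [hins] at this
    exact hC.not_indep this
  obtain ⟨C', hC's, hC'⟩ := hdep.exists_isCircuit_subset
  have hpC' : p ∈ C' := by
    by_contra hcon
    exact hC'.not_indep (hDind.subset ((Set.subset_insert_iff_of_notMem hcon).1 hC's))
  have hfC' : f ∉ C' := by
    intro hfC'
    rcases hC's hfC' with h' | h'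
    exacts [hfp h', hfD h']
  have hD' : C' \ {p} ⊆ C \ {f} := by
    rintro z ⟨hz, hzp⟩
    exact (hC's hz).resolve_left hzp
  have hins' : insert p (C' \ {p}) = C' := by
    rw [Set.insert_sdiff_singleton, Set.insert_eq_of_mem hpC']
  have hdep' : M.Dep (insert f (C' \ {p})) := by
    refine ⟨fun hI ↦ ?_, Set.insert_subset hf (hD'.trans hDE)⟩
    have := hsw f hf p hp hends _ (hD'.trans hDE) (fun h ↦ hfC' h.1) (fun h ↦ h.2 rfl) hI
    rw [hins'] at this
    exact hC'.not_indep this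
  have heq := hC.eq_of_dep_subset hdep' (by
    rw [← hins]
    exact Set.insert_subset_insert hD')
  have : C' \ {p} = C \ {f} := by
    rw [← heq, Set.insert_sdiff_self_of_notMem fun h ↦ hfC' h.1]
  rw [← this, hins']
  exact hC'

end Matroid


/-! ### Cycles, chords and longest paths. -/

theorem Fin.eq_univ_of_forall_add_one_mem {n : ℕ} {T : Finset (Fin (n + 1))} (hT : T.Nonempty)
    (h : ∀ i ∈ T, i + 1 ∈ T) : T = Finset.univ := by
  obtain ⟨i, hi⟩ := hT
  have key : ∀ k : ℕ, i + (Fin.ofNat (n + 1) k) ∈ T := by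
    intro k
    induction k with
    | zero => simpa using hi
    | succ k ih =>
      have := h _ ih
      have heq : Fin.ofNat (n + 1) (k + 1) = Fin.ofNat (n + 1) k + 1 := by
        ext; simp [Fin.ofNat, Fin.val_add]
      rwa [heq, ← add_assoc]
  ext j
  simp only [Finset.mem_univ, iff_true]
  have := key (j - i).val
  rw [Fin.ofNat_val_eq_self] at this
  simpa using this

theorem Nat.exists_forall_le_of_bounded {P : ℕ → Prop} {B : ℕ} (hB : ∀ n, P n → n ≤ B)
    (h : ∃ n, P n) : ∃ n, P n ∧ ∀ m, P m → m ≤ n := by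
  classical
  obtain ⟨n, hn⟩ := h
  exact ⟨Nat.findGreatest P B, Nat.findGreatest_spec (hB n hn) hn,
    fun m hm ↦ Nat.le_findGreatest (hB m hm) hm⟩

namespace Matroid

variable {β W : Type*}

/-- The edges of a cyclic sequence of vertices form a set in which every proper nonempty subset
covers more vertices than it has edges. -/
theorem card_lt_card_biUnion_of_cycle [DecidableEq W] [DecidableEq β] {ends : β → Finset W}
    {n : ℕ} {v : Fin (n + 1) → W} {e : Fin (n + 1) → β} (hv : Function.Injective v)
    (he : ∀ i, ends (e i) = {v i, v (i + 1)}) {L : Finset β}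
    (hL : L ⊆ Finset.univ.image e) (hLn : L.Nonempty) (hne : L ≠ Finset.univ.image e) :
    L.card < (L.biUnion ends).card := by
  by_contra! hcon
  set T : Finset (Fin (n + 1)) := Finset.univ.filter fun i ↦ e i ∈ L with hT
  have hTL : T.image e = L := by
    ext x
    simp only [hT, Finset.mem_image, Finset.mem_filter, Finset.mem_univ, true_and]
    constructor
    · rintro ⟨i, hi, rfl⟩; exact hi
    · intro hx
      obtain ⟨i, -, rfl⟩ := Finset.mem_image.1 (hL hx)
      exact ⟨i, hx, rfl⟩
  have hTn : T.Nonempty := by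
    rw [← hTL] at hLn
    exact Finset.image_nonempty.1 hLn
  have hsub : (T ∪ T.image (· + 1)).image v ⊆ L.biUnion ends := by
    intro w hw
    simp only [Finset.mem_image, Finset.mem_union] at hw
    obtain ⟨i, hi | ⟨j, hj, rfl⟩, rfl⟩ := hw
    · exact Finset.mem_biUnion.2 ⟨e i, (Finset.mem_filter.1 hi).2, by simp [he]⟩
    · exact Finset.mem_biUnion.2 ⟨e j, (Finset.mem_filter.1 hj).2, by simp [he]⟩
  -- `T` indexes the edges of `L`, whose ends are indexed by `T` and its shift. Without a surplus
  -- `T` is closed under the cyclic shift, hence everything.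
  have h1 : (T ∪ T.image (· + 1)).card ≤ T.card := by
    rw [← Finset.card_image_of_injective _ hv]
    refine (Finset.card_le_card hsub).trans (hcon.trans ?_)
    rw [← hTL]
    exact Finset.card_image_le
  have h2 := Finset.eq_of_subset_of_card_le Finset.subset_union_left h1
  have h3 := Fin.eq_univ_of_forall_add_one_mem hTn fun i hi ↦ by
    rw [h2]
    exact Finset.mem_union_right _ (Finset.mem_image_of_mem _ hi)
  exact hne (by rw [← hTL, h3])

theorem biUnion_image_of_cycle [DecidableEq W] [DecidableEq β] {ends : β → Finset W}
    {n : ℕ} {v : Fin (n + 1) → W} {e : Fin (n + 1) → β}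
    (he : ∀ i, ends (e i) = {v i, v (i + 1)}) :
    (Finset.univ.image e).biUnion ends = Finset.univ.image v := by
  ext w
  simp only [Finset.mem_biUnion, Finset.mem_image, Finset.mem_univ, true_and]
  constructor
  · rintro ⟨_, ⟨i, rfl⟩, hw⟩
    rw [he, Finset.mem_insert, Finset.mem_singleton] at hw
    rcases hw with rfl | rfl
    exacts [⟨i, rfl⟩, ⟨i + 1, rfl⟩]
  · rintro ⟨i, rfl⟩
    exact ⟨_, ⟨i, rfl⟩, by simp [he]⟩

/-- Two chords of a cycle yield two circuits which differ by an exchange. -/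
theorem IsPresentedBy.isCircuit_insert_chord [DecidableEq W] [Nonempty W] {M : Matroid β} {ends : β → Finset W}
    (h : M.IsPresentedBy ends) {n : ℕ} {v : Fin (n + 1) → W} {e : Fin (n + 1) → β}
    (hv : Function.Injective v) (hei : Function.Injective e) (heE : ∀ i, e i ∈ M.E)
    (he : ∀ i, ends (e i) = {v i, v (i + 1)}) {f : β} (hfE : f ∈ M.E) (hf : f ∉ Set.range e)
    (hfn : (ends f).Nonempty) (hfv : ∀ w ∈ ends f, w ∈ Set.range v) :
    M.IsCircuit (insert f (Set.range e)) := by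
  classical
  have hr : ((Finset.univ.image e : Finset β) : Set β) = Set.range e := by simp
  rw [← hr]
  refine h.isCircuit_insert ?_ hfE (by simpa using hf) hfn ?_ ?_
    fun L hL hLn hne ↦ card_lt_card_biUnion_of_cycle hv he hL hLn hne
  · rw [hr]
    rintro _ ⟨i, rfl⟩
    exact heE i
  · rw [biUnion_image_of_cycle he]
    intro w hw
    simpa using hfv w hw
  · rw [biUnion_image_of_cycle he, Finset.card_image_of_injective _ hv,
      Finset.card_image_of_injective _ hei]

/-- This is Pósa's rotation: a chord from the first vertex to `w` allows the part before `w` to be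
reversed, so that the old predecessor of `w` comes first. -/
theorem _root_.List.IsChain.rotate_path {α : Type*} {R : α → α → Prop} (hR : ∀ a b, R a b → R b a)
    {p r : List α} {w x : α} (h : List.IsChain R (p ++ w :: r)) (hx : x ∈ p.head?) (hxw : R x w) :
    List.IsChain R (p.reverse ++ w :: r) := by
  rw [List.isChain_append] at h ⊢
  refine ⟨?_, h.2.1, ?_⟩
  · rw [List.isChain_reverse]
    exact h.1.imp fun a b hab ↦ hR _ _ hab
  · intro a ha b hb
    rw [List.getLast?_reverse] at ha
    have : a = x := Option.mem_unique ha hx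
    have hb' : b = w := by simpa using hb.symm
    rw [this, hb']
    exact hxw

/-- For a symmetric relation `R` on a finite set there is a path `a ++ b`, the first and last vertex of `a`
being adjacent, such that all neighbours of the first vertex, and of the first vertex of each path
obtained from it by a rotation, are in `a`. -/
theorem _root_.List.exists_path_with_cycle {α : Type*} {R : α → α → Prop}
    (hR : ∀ a b, R a b → R b a) (hirr : ∀ a, ¬ R a a) (V : Finset α) (hV : V.Nonempty)
    (hRV : ∀ a ∈ V, ∃ b, R a b) (hRV' : ∀ a b, R a b → a ∈ V) :
    ∃ (a b : List α) (x y : α), (a ++ b).Nodup ∧ (a ++ b).IsChain R ∧ (∀ z ∈ a, z ∈ V) ∧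
      x ∈ a.head? ∧ y ∈ a.getLast? ∧ R x y ∧ (∀ w, R w x → w ∈ a) ∧
      ∀ p w r, a = p ++ w :: r → R x w → ∀ z ∈ p.getLast?, ∀ u, R u z → u ∈ a := by
  classical
  set Path : List α → Prop := fun l ↦ l.Nodup ∧ l.IsChain R ∧ ∀ z ∈ l, z ∈ V with hPath
  have hbound : ∀ l, Path l → l.length ≤ V.card := by
    intro l hl
    rw [← List.toFinset_card_of_nodup hl.1]
    exact Finset.card_le_card fun z hz ↦ hl.2.2 z (by simpa using hz)
  obtain ⟨N, ⟨l₀, hl₀, hl₀n, hl₀N⟩, hN⟩ := Nat.exists_forall_le_of_bounded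
    (P := fun n ↦ ∃ l, Path l ∧ l ≠ [] ∧ l.length = n) (B := V.card)
    (by rintro _ ⟨l, hl, -, rfl⟩; exact hbound l hl)
    (by
      obtain ⟨a, ha⟩ := hV
      exact ⟨1, [a], ⟨by simp, by simp, by simpa using ha⟩, by simp, rfl⟩)
  have hmax : ∀ l, Path l → l.length = N → ∀ x ∈ l.head?, ∀ w, R w x → w ∈ l := by
    intro l hl hlN x hx w hwx
    by_contra hwl
    have := hN _ ⟨w :: l, ⟨List.nodup_cons.2 ⟨hwl, hl.1⟩, ?_, ?_⟩, by simp, rfl⟩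
    · simp [hlN] at this
    · rw [List.isChain_cons]
      exact ⟨fun y hy ↦ Option.mem_unique hx hy ▸ hwx, hl.2.1⟩
    · intro z hz
      rcases List.mem_cons.1 hz with rfl | hz
      exacts [hRV' _ _ hwx, hl.2.2 z hz]
  -- Among the longest paths, one is chosen whose initial segment closed up by an edge to the first
  -- vertex is as long as possible.
  obtain ⟨K, ⟨a, b, x, y, hab, habN, hx, hy, hxy, haK⟩, hK⟩ := Nat.exists_forall_le_of_bounded
    (P := fun k ↦ ∃ (a b : List α) (x y : α), Path (a ++ b) ∧ (a ++ b).length = N ∧ x ∈ a.head? ∧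
      y ∈ a.getLast? ∧ R x y ∧ a.length = k) (B := N)
    (by
      rintro _ ⟨a, b, x, y, -, h, -, -, -, rfl⟩
      rw [← h, List.length_append]
      exact Nat.le_add_right _ _)
    (by
      obtain ⟨x, t, rfl⟩ := List.exists_cons_of_ne_nil hl₀n
      obtain ⟨w, hw⟩ := hRV x (hl₀.2.2 x (by simp))
      have hwl := hmax _ hl₀ hl₀N x (by simp) w (hR _ _ hw)
      have hwt : w ∈ t := by
        rcases List.mem_cons.1 hwl with rfl | h
        exacts [absurd hw (hirr _), h]
      obtain ⟨s, r, rfl⟩ := List.append_of_mem hwt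
      exact ⟨_, x :: s ++ [w], r, x, w, by simpa using hl₀, by simpa using hl₀N, by simp,
        by rw [List.getLast?_append]; simp, hw, rfl⟩)
  -- Only the length of `a'` matters, not that it closes up: a neighbour of the first vertex in `b'`
  -- would give a closed segment longer than `K`. Hence this also applies to rotated paths.
  have hnbr : ∀ a' b', Path (a' ++ b') → (a' ++ b').length = N → a'.length = K →
      ∀ x ∈ a'.head?, ∀ w, R w x → w ∈ a' := by
    intro a' b' hab' habN' haK' x hx w hwx
    have hw := hmax _ hab' habN' x (List.mem_head?_append_of_mem_head? hx) w hwx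
    by_contra hwa
    have hwb := (List.mem_append.1 hw).resolve_left hwa
    obtain ⟨s, r, rfl⟩ := List.append_of_mem hwb
    have := hK _ ⟨a' ++ s ++ [w], r, x, w, by simpa using hab', by simpa using habN', by
      rw [List.append_assoc]
      exact List.mem_head?_append_of_mem_head? hx, by simp, hR _ _ hwx, rfl⟩
    simp only [List.length_append, List.length_singleton] at this
    omega
  refine ⟨a, b, x, y, hab.1, hab.2.1, fun z hz ↦ hab.2.2 z (by simp [hz]), hx, hy, hxy,
    hnbr a b hab habN haK x hx, ?_⟩
  rintro p w r rfl hxw z hz u huz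
  have hpn : p ≠ [] := by rintro rfl; simp at hz
  have hxp : x ∈ p.head? := by
    obtain ⟨q, t, rfl⟩ := List.exists_cons_of_ne_nil hpn
    simpa using hx
  have hperm : (p.reverse ++ w :: r ++ b).Perm (p ++ w :: r ++ b) :=
    ((List.reverse_perm p).append_right _).append_right _
  have hrot : Path (p.reverse ++ w :: r ++ b) := by
    refine ⟨hperm.nodup_iff.2 hab.1, ?_, fun z hz ↦ hab.2.2 z (hperm.mem_iff.1 hz)⟩
    have := hab.2.1
    rw [List.append_assoc, List.cons_append] at this ⊢
    exact this.rotate_path hR hxp hxw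
  have := hnbr (p.reverse ++ w :: r) b hrot (hperm.length_eq.trans habN)
    ((((List.reverse_perm p).append_right _).length_eq).trans haK) z (by
      apply List.mem_head?_append_of_mem_head?
      rwa [List.head?_reverse]) u huz
  exact ((List.reverse_perm p).append_right _).mem_iff.1 this

/-- Otherwise distinct edges have distinct nonempty end sets, and every vertex in use lies on at
least three edges. The initial segment from `List.exists_path_with_cycle` is a cycle whose first
vertex, both before and after a rotation, has all its neighbours on the cycle, so its third edge is
a chord. Edges with a single end on the cycle count as chords. -/
theorem IsPresentedBy.exists_loop_or_exchange [Nonempty W] {M : Matroid β} {ends : β → Finset W}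
    (h : M.IsPresentedBy ends) (hfin : M.E.Finite) (hM : M.IsCosimple) (hne : M.E.Nonempty) :
    (∃ f, M.IsLoop f) ∨ ∃ D f g, f ≠ g ∧ f ∉ D ∧ g ∉ D ∧ M.IsCircuit (insert f D) ∧
      M.IsCircuit (insert g D) := by
  classical
  by_contra! hcon
  obtain ⟨hloop, hex⟩ := hcon
  have hnonempty : ∀ e ∈ M.E, (ends e).Nonempty := by
    intro e he
    rw [Finset.nonempty_iff_ne_empty]
    exact fun h0 ↦ hloop e (h.isLoop_of_ends_eq_empty he h0)
  have hinj : ∀ e ∈ M.E, ∀ f ∈ M.E, ends e = ends f → e = f := by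
    intro e he f hf hef
    by_contra hne
    obtain ⟨D, h1, h2, h3, h4⟩ := h.exists_exchange_of_ends_eq hM he hf hne hef
    exact hex D e f hne h1 h2 h3 h4
  set R : W → W → Prop := fun x y ↦ x ≠ y ∧ ∃ e ∈ M.E, ends e = {x, y} with hRdef
  have hRsymm : ∀ a b, R a b → R b a := by
    rintro a b ⟨h1, e, he, h2⟩
    exact ⟨h1.symm, e, he, by rw [h2, Finset.pair_comm]⟩
  have hends : ∀ e ∈ M.E, ∀ x ∈ ends e, ends e = {x} ∨ ∃ w, R x w ∧ ends e = {x, w} := by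
    intro e he x hx
    by_cases hc : ends e = {x}
    · exact Or.inl hc
    right
    obtain ⟨w, hw, hwx⟩ : ∃ w ∈ ends e, w ≠ x := by
      by_contra! hcon
      exact hc (Finset.eq_singleton_iff_unique_mem.2 ⟨hx, hcon⟩)
    have heq : ({x, w} : Finset W) = ends e := by
      refine Finset.eq_of_subset_of_card_le (Finset.insert_subset hx (by simpa using hw)) ?_
      rw [Finset.card_pair hwx.symm]
      exact h.card_le e
    exact ⟨w, ⟨hwx.symm, e, he, heq.symm⟩, heq.symm⟩
  set V := hfin.toFinset.biUnion ends with hVdef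
  have hmemV : ∀ x, x ∈ V ↔ ∃ e ∈ M.E, x ∈ ends e := by simp [hVdef]
  have hthree : ∀ x ∈ V, ∀ f g, ∃ e ∈ M.E, x ∈ ends e ∧ e ≠ f ∧ e ≠ g := by
    intro x hx f g
    obtain ⟨e, he, hxe⟩ := (hmemV x).1 hx
    by_contra! hcon
    have h3 := h.three_le_encard hM he hxe
    have hs : {f ∈ M.E | x ∈ ends f} ⊆ {f, g} := by
      rintro e ⟨he, hxe⟩
      by_cases hef : e = f
      · exact Or.inl hef
      · exact Or.inr (hcon e he hxe hef)
    have := h3.trans ((Set.encard_le_encard hs).trans (Set.encard_insert_le _ _))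
    rw [Set.encard_singleton] at this
    exact absurd this (by norm_num)
  obtain ⟨a, b, x, y, hnodup, hchain, haV, hx, hy, hxy, hxn, hrot⟩ :=
    List.exists_path_with_cycle hRsymm (fun a ha ↦ ha.1 rfl) V (by
      obtain ⟨e, he⟩ := hne
      obtain ⟨x, hx⟩ := hnonempty e he
      exact ⟨x, (hmemV x).2 ⟨e, he, hx⟩⟩) (by
      intro x hx
      obtain ⟨e, he, hxe⟩ := (hmemV x).1 hx
      obtain ⟨f, hf, hxf, hfe, -⟩ := hthree x hx e e
      rcases hends e he x hxe with h1 | ⟨w, hw, -⟩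
      · rcases hends f hf x hxf with h2 | ⟨w, hw, -⟩
        · exact absurd (hinj f hf e he (h2.trans h1.symm)) hfe
        · exact ⟨w, hw⟩
      · exact ⟨w, hw⟩) (by
      rintro a b ⟨-, e, he, h1⟩
      exact (hmemV a).2 ⟨e, he, by simp [h1]⟩)
  have hanodup : a.Nodup := (List.nodup_append.1 hnodup).1
  have hachain : a.IsChain R := (List.isChain_append.1 hchain).1
  have hxa : x ∈ a := List.mem_of_mem_head? hx
  have hya : y ∈ a := List.mem_of_mem_getLast? hy
  obtain ⟨n, hn⟩ : ∃ n, a.length = n + 1 :=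
    Nat.exists_eq_succ_of_ne_zero (List.length_pos_of_mem hxa).ne'
  set v : Fin (n + 1) → W := fun i ↦ a[i.val]'(by omega) with hvdef
  have hvinj : Function.Injective v := by
    intro i j hij
    exact Fin.ext ((hanodup.getElem_inj_iff).1 hij)
  have hv0 : v 0 = x := by
    rw [List.head?_eq_getElem?] at hx
    exact (List.getElem?_eq_some_iff.1 hx).2
  have hvn : v (Fin.last n) = y := by
    rw [List.getLast?_eq_getElem?] at hy
    obtain ⟨h1, h2⟩ := List.getElem?_eq_some_iff.1 hy
    rw [← h2, hvdef]
    simp [hn]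
  have hvr : ∀ w, w ∈ a ↔ w ∈ Set.range v := by
    intro w
    rw [List.mem_iff_getElem]
    constructor
    · rintro ⟨i, hi, rfl⟩
      exact ⟨⟨i, by omega⟩, rfl⟩
    · rintro ⟨i, rfl⟩
      exact ⟨i, by omega, rfl⟩
  have hvR : ∀ i, R (v i) (v (i + 1)) := by
    intro i
    by_cases hi : i = Fin.last n
    · rw [hi, Fin.last_add_one, hvn, hv0]
      exact hRsymm _ _ hxy
    · have hlt : i.val < n := Fin.val_lt_last hi
      have h1 := List.isChain_iff_getElem.1 hachain i.val (by omega)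
      have h2 : v (i + 1) = a[i.val + 1]'(by omega) := by
        simp only [hvdef, Fin.val_add_one_of_lt (Fin.lt_last_iff_ne_last.2 hi)]
      rw [h2]
      exact h1
  choose hvne e heE he using hvR
  -- With at most two vertices, all edges at `x` other than `e 0` would have `x` as their only end,
  -- and two such edges would have equal ends.
  have hn2 : 2 ≤ n := by
    by_contra hlt
    have hxV := haV x hxa
    have hlp : ∀ f ∈ M.E, x ∈ ends f → f ≠ e 0 → ends f = {x} := by
      intro f hf hxf hfe
      rcases hends f hf x hxf with h1 | ⟨w, hw, h1⟩
      · exact h1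
      · obtain ⟨k, rfl⟩ := (hvr w).1 (hxn w (hRsymm _ _ hw))
        exfalso
        have hk0 : k ≠ 0 := by rintro rfl; exact hw.1 hv0.symm
        have hk1 : k = 0 + 1 := by
          have : k.val ≠ 0 := fun h ↦ hk0 (Fin.ext h)
          have hn1 : n = 1 := by omega
          subst hn1
          ext
          simp
          omega
        refine hfe (hinj f hf _ (heE 0) ?_)
        rw [he, h1, hv0, hk1]
    obtain ⟨e₁, h1, h2, h3, -⟩ := hthree x hxV (e 0) (e 0)
    obtain ⟨e₂, h1', h2', h3', h4'⟩ := hthree x hxV (e 0) e₁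
    exact h4' (hinj _ h1' _ h1 ((hlp _ h1' h2' h3').trans (hlp _ h1 h2 h3).symm))
  have heinj : Function.Injective e := by
    intro i j hij
    have h1 : ({v i, v (i + 1)} : Finset W) = {v j, v (j + 1)} := by rw [← he, ← he, hij]
    have h2 : v i ∈ ({v j, v (j + 1)} : Finset W) := h1 ▸ Finset.mem_insert_self _ _
    have h3 : v (i + 1) ∈ ({v j, v (j + 1)} : Finset W) :=
      h1 ▸ Finset.mem_insert_of_mem (Finset.mem_singleton_self _)
    simp only [Finset.mem_insert, Finset.mem_singleton, hvinj.eq_iff] at h2 h3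
    rcases h2 with h2 | h2
    · exact h2
    rcases h3 with h3 | h3
    · exfalso
      rw [h2, add_assoc, add_eq_left] at h3
      have := congrArg Fin.val h3
      rw [Fin.val_add, Fin.val_one', Fin.val_zero, Nat.mod_eq_of_lt (by omega : 1 < n + 1),
        Nat.mod_eq_of_lt (by omega)] at this
      omega
    · exact add_right_cancel h3
  have hchord : ∀ i, (∀ u, R u (v i) → u ∈ a) → ∃ f ∈ M.E, f ∉ Set.range e ∧ v i ∈ ends f ∧
      (∀ w ∈ ends f, w ∈ Set.range v) := by
    intro i hi
    have hia : v i ∈ a := (hvr _).2 ⟨i, rfl⟩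
    obtain ⟨f, hfE, hif, hf1, hf2⟩ := hthree (v i) (haV _ hia) (e i) (e (i - 1))
    refine ⟨f, hfE, ?_, hif, fun w hw ↦ (hvr w).1 ?_⟩
    · rintro ⟨j, rfl⟩
      rw [he, Finset.mem_insert, Finset.mem_singleton, hvinj.eq_iff, hvinj.eq_iff] at hif
      rcases hif with rfl | rfl
      · exact hf1 rfl
      · rw [add_sub_cancel_right] at hf2
        exact hf2 rfl
    · rcases hends f hfE _ hif with h1 | ⟨u, hu, h1⟩
      · rw [h1, Finset.mem_singleton] at hw
        exact hw ▸ hia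
      · rw [h1, Finset.mem_insert, Finset.mem_singleton] at hw
        rcases hw with rfl | rfl
        exacts [hia, hi _ (hRsymm _ _ hu)]
  obtain ⟨f, hfE, hfe, hf0, hfv⟩ := hchord 0 (hv0 ▸ hxn)
  -- The second chord is taken at the predecessor of a neighbour of `x`: the other end of `f`, or
  -- `y` if `x` is the only end of `f`. Then `f` misses that predecessor, so the two chords differ.
  obtain ⟨t, ht0, ht, hRt⟩ : ∃ (t : ℕ) (ht : t + 2 < n + 1), v ⟨t + 1, by omega⟩ ∉ ends f ∧
      R x (v ⟨t + 2, ht⟩) := by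
    rw [hv0] at hf0
    rcases hends f hfE x hf0 with h1 | ⟨w, hw, h1⟩
    · refine ⟨n - 2, by omega, ?_, ?_⟩
      · rw [h1, Finset.mem_singleton, ← hv0, hvinj.eq_iff]
        intro h2
        simpa using congrArg Fin.val h2
      · have : (⟨n - 2 + 2, by omega⟩ : Fin (n + 1)) = Fin.last n := by ext; simp; omega
        rw [this, hvn]
        exact hxy
    · obtain ⟨k, rfl⟩ := (hvr w).1 (hxn w (hRsymm _ _ hw))
      have hk0 : k.val ≠ 0 := by
        intro hk
        have : k = 0 := Fin.ext hk
        rw [this, hv0] at hw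
        exact hw.1 rfl
      have hk1 : k.val ≠ 1 := by
        intro hk
        have : k = 0 + 1 := by
          ext
          rw [zero_add, Fin.val_one', Nat.mod_eq_of_lt (by omega), hk]
        refine hfe ⟨0, (hinj f hfE _ (heE 0) ?_).symm⟩
        rw [he, h1, hv0, this]
      have hk2 : (⟨k.val - 2 + 2, by omega⟩ : Fin (n + 1)) = k := by ext; simp; omega
      refine ⟨k.val - 2, by omega, ?_, by rw [hk2]; exact hw⟩
      rw [h1, Finset.mem_insert, Finset.mem_singleton, ← hv0, hvinj.eq_iff, hvinj.eq_iff]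
      rintro (h2 | h2)
      · simpa using congrArg Fin.val h2
      · have := congrArg Fin.val h2
        simp only at this
        omega
  obtain ⟨g, hgE, hge, hg0, hgv⟩ := hchord ⟨t + 1, by omega⟩ (by
    refine hrot (a.take (t + 2)) (v ⟨t + 2, ht0⟩) (a.drop (t + 3)) ?_ hRt _ ?_
    · have h1 := List.take_append_drop (t + 2) a
      rw [List.drop_eq_getElem_cons (by omega)] at h1
      exact h1.symm
    · rw [List.getLast?_eq_getElem?, List.length_take, min_eq_left (by omega),
        List.getElem?_take_of_lt (by omega)]
      exact List.getElem?_eq_getElem _)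
  refine hex (Set.range e) f g (fun hfg ↦ ht (hfg ▸ hg0)) hfe hge ?_ ?_
  · exact h.isCircuit_insert_chord hvinj heinj heE he hfE hfe ⟨_, hf0⟩ hfv
  · exact h.isCircuit_insert_chord hvinj heinj heE he hgE hge ⟨_, hg0⟩ hgv

end Matroid

/-! ### Bicircular independence as a system of distinct representatives. -/

namespace Graph

variable {V β : Type*}

theorem finite_setOf_inc (G : Graph V β) (e : β) : {x | G.Inc e x}.Finite := by
  by_cases h : e ∈ G.edgeSet
  · obtain ⟨x, y, hxy⟩ := exists_isLink_of_mem_edgeSet h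
    exact (Set.toFinite {x, y}).subset fun z hz ↦ hz.eq_or_eq_of_isLink hxy
  · convert! Set.finite_empty
    ext x
    simp [h]

/-- The set of end vertices of an edge. -/
noncomputable def ends (G : Graph V β) (e : β) : Finset V := (G.finite_setOf_inc e).toFinset

@[simp]
theorem mem_ends {G : Graph V β} {e : β} {x : V} : x ∈ G.ends e ↔ G.Inc e x := by
  simp [ends]

theorem IsLink.ends_eq [DecidableEq V] {G : Graph V β} {e : β} {x y : V} (h : G.IsLink e x y) :
    G.ends e = {x, y} := by
  ext z
  simp only [mem_ends, Finset.mem_insert, Finset.mem_singleton]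
  constructor
  · exact fun hz ↦ hz.eq_or_eq_of_isLink h
  · rintro (rfl | rfl)
    exacts [h.inc_left, h.inc_right]

theorem card_ends_le (G : Graph V β) (e : β) : (G.ends e).card ≤ 2 := by
  classical
  by_cases h : e ∈ G.edgeSet
  · obtain ⟨x, y, hxy⟩ := exists_isLink_of_mem_edgeSet h
    rw [hxy.ends_eq]
    exact Finset.card_le_two
  · have : G.ends e = ∅ := by ext x; simp [h]
    simp [this]

theorem ends_nonempty {G : Graph V β} {e : β} (h : e ∈ G.edgeSet) : (G.ends e).Nonempty := by
  obtain ⟨x, y, hxy⟩ := exists_isLink_of_mem_edgeSet h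
  exact ⟨x, mem_ends.2 hxy.inc_left⟩

/-- A cycle has as many edges as vertices, so the injective choice of ends reaches all of its
vertices. -/
theorem exists_apply_eq_of_cycle {G : Graph V β} {I : Set β} {φ : β → V} (hφ : Set.InjOn φ I)
    (hφe : ∀ e ∈ I, φ e ∈ G.ends e) {n : ℕ} {v : Fin (n + 1) → V} {e : Fin (n + 1) → β}
    (he : Function.Injective e) (hl : ∀ i, G.IsLink (e i) (v i) (v (i + 1)))
    (hI : Set.range e ⊆ I) (i : Fin (n + 1)) : ∃ j, φ (e j) = v i := by
  have hex : ∀ j, ∃ k, v k = φ (e j) := by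
    intro j
    rcases (mem_ends.1 (hφe _ (hI ⟨j, rfl⟩))).eq_or_eq_of_isLink (hl j) with h | h
    exacts [⟨_, h.symm⟩, ⟨_, h.symm⟩]
  choose k hk using hex
  have hkinj : Function.Injective k := by
    intro a b hab
    exact he (hφ (hI ⟨a, rfl⟩) (hI ⟨b, rfl⟩) (by rw [← hk, ← hk, hab]))
  obtain ⟨j, rfl⟩ := Finite.surjective_of_injective hkinj i
  exact ⟨j, (hk j).symm⟩

/-- The edge represented by a common vertex lies in both cycles, so both its ends are common. Thus
there are at least as many edges of the first cycle with both ends common as there are common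
vertices; the common vertices are closed under the cyclic shift and exhaust the cycle. -/
theorem range_subset_of_common_vertex {G : Graph V β} {I : Set β} {φ : β → V}
    (hφ : Set.InjOn φ I) (hφe : ∀ e ∈ I, φ e ∈ G.ends e) {n m : ℕ}
    {v : Fin (n + 1) → V} {e : Fin (n + 1) → β} {w : Fin (m + 1) → V} {f : Fin (m + 1) → β}
    (hv : Function.Injective v) (he : Function.Injective e)
    (hl : ∀ i, G.IsLink (e i) (v i) (v (i + 1)))
    (hI : Set.range e ⊆ I) (hf : Function.Injective f)
    (hl' : ∀ i, G.IsLink (f i) (w i) (w (i + 1))) (hI' : Set.range f ⊆ I) {i₀ : Fin (n + 1)}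
    {j₀ : Fin (m + 1)} (h : v i₀ = w j₀) : Set.range e ⊆ Set.range f := by
  classical
  have key : ∀ i, φ (e i) ∈ Set.range w → e i ∈ Set.range f := by
    rintro i ⟨j, hj⟩
    obtain ⟨k, hk⟩ := exists_apply_eq_of_cycle hφ hφe hf hl' hI' j
    exact ⟨k, hφ (hI' ⟨k, rfl⟩) (hI ⟨i, rfl⟩) (hk.trans hj)⟩
  have hends : ∀ i, e i ∈ Set.range f → v i ∈ Set.range w ∧ v (i + 1) ∈ Set.range w := by
    rintro i ⟨k, hk⟩
    have h1 := hl i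
    rw [← hk] at h1
    constructor
    · rcases h1.inc_left.eq_or_eq_of_isLink (hl' k) with h | h
      exacts [⟨_, h.symm⟩, ⟨_, h.symm⟩]
    · rcases h1.inc_right.eq_or_eq_of_isLink (hl' k) with h | h
      exacts [⟨_, h.symm⟩, ⟨_, h.symm⟩]
  set T : Finset (Fin (n + 1)) := Finset.univ.filter fun i ↦ v i ∈ Set.range w with hT
  set T' : Finset (Fin (n + 1)) := T.filter fun i ↦ i + 1 ∈ T with hT'
  choose o ho using exists_apply_eq_of_cycle hφ hφe he hl hI
  have hcard : T.card ≤ T'.card := by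
    refine Finset.card_le_card_of_injOn o ?_ ?_
    · intro i hi
      have hi' : v i ∈ Set.range w := (Finset.mem_filter.1 hi).2
      have := hends _ (key (o i) (by rwa [ho]))
      simpa [hT', hT] using this
    · intro a _ b _ hab
      exact hv (by rw [← ho, ← ho, hab])
  have hTT : T' = T := Finset.eq_of_subset_of_card_le (Finset.filter_subset _ _) hcard
  have hun := Fin.eq_univ_of_forall_add_one_mem (T := T) ⟨i₀, by simp [hT, h]⟩ fun i hi ↦ by
    rw [← hTT] at hi
    exact (Finset.mem_filter.1 hi).2
  rintro _ ⟨i, rfl⟩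
  refine key i ?_
  have hall : ∀ i, v i ∈ Set.range w := fun i ↦
    (Finset.mem_filter.1 (hun ▸ Finset.mem_univ i : i ∈ T)).2
  rcases (mem_ends.1 (hφe _ (hI ⟨i, rfl⟩))).eq_or_eq_of_isLink (hl i) with h | h
  · rw [h]; exact hall _
  · rw [h]; exact hall _

/-- Each edge is oriented away from its representative, so at most one edge leaves each vertex.
Directed walks cannot leave a cycle, and every vertex joined to the first cycle has a directed walk
into it. A directed walk from the second cycle therefore shows that the cycles meet. -/
theorem bicircularIndep_of_hasSDR {G : Graph V β} {I : Set β} (hIE : I ⊆ G.edgeSet)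
    (h : Matroid.HasSDR G.ends I) : G.BicircularIndep I := by
  obtain ⟨φ, hφ, hφe⟩ := h
  refine ⟨hIE, ?_⟩
  rintro _ _ hI₁ hI₂ ⟨n, v, e, hv, he, hl, rfl⟩ ⟨m, w, f, hw, hf, hl', rfl⟩
    ⟨_, ⟨i, rfl⟩, _, ⟨j, rfl⟩, x, y, hx, hy, hxy⟩
  set N : V → V → Prop := fun a b ↦ ∃ e ∈ I, φ e = a ∧ G.IsLink e a b with hN
  have hclosed : ∀ {n : ℕ} {v : Fin (n + 1) → V} {e : Fin (n + 1) → β},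
      Function.Injective e → (∀ i, G.IsLink (e i) (v i) (v (i + 1))) → Set.range e ⊆ I →
      ∀ a b, a ∈ Set.range v → N a b → b ∈ Set.range v := by
    rintro n v e he hl hI _ b ⟨i, rfl⟩ ⟨g, hg, hga, hgl⟩
    obtain ⟨j, hj⟩ := exists_apply_eq_of_cycle hφ hφe he hl hI i
    have : g = e j := hφ hg (hI ⟨j, rfl⟩) (hga.trans hj.symm)
    rw [this] at hgl
    rcases hgl.inc_right.eq_or_eq_of_isLink (hl j) with h | h
    exacts [⟨_, h.symm⟩, ⟨_, h.symm⟩]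
  have hxv : x ∈ Set.range v := by
    rcases hx.eq_or_eq_of_isLink (hl i) with h | h
    exacts [⟨_, h.symm⟩, ⟨_, h.symm⟩]
  have hyw : y ∈ Set.range w := by
    rcases hy.eq_or_eq_of_isLink (hl' j) with h | h
    exacts [⟨_, h.symm⟩, ⟨_, h.symm⟩]
  have hland : ∀ b, G.JoinedIn I x b → ∃ c ∈ Set.range v, Relation.ReflTransGen N b c := by
    intro b hxb
    induction hxb with
    | refl => exact ⟨x, hxv, .refl⟩
    | @tail a b _ hab ih =>
      obtain ⟨g, hg, hgl⟩ := hab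
      obtain ⟨c, hc, hac⟩ := ih
      -- If `g` leaves `a`, it is the first step of the directed walk from `a`, unless `a` is
      -- already on the cycle. If `g` leaves `b`, it is put in front of that walk.
      rcases (mem_ends.1 (hφe g hg)).eq_or_eq_of_isLink hgl with h | h
      · rcases Relation.ReflTransGen.cases_head hac with rfl | ⟨b', ⟨g', hg', hga', hgl'⟩, hb'⟩
        · exact ⟨b, hclosed he hl hI₁ _ b hc ⟨g, hg, h, hgl⟩, .refl⟩
        · have : g' = g := hφ hg' hg (hga'.trans h.symm)
          subst this
          rw [hgl.right_unique hgl']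
          exact ⟨c, hc, hb'⟩
      · exact ⟨c, hc, .head ⟨g, hg, h, hgl.symm⟩ hac⟩
  obtain ⟨c, ⟨i', hc⟩, hyc⟩ := hland y hxy
  have hcw : c ∈ Set.range w := by
    clear hc hy hxy
    induction hyc with
    | refl => exact hyw
    | tail _ h ih => exact hclosed hf hl' hI₂ _ _ ih h
  obtain ⟨j', hj'⟩ := hcw
  exact (range_subset_of_common_vertex hφ hφe hv he hl hI₁ hf hl' hI₂ (hc.trans hj'.symm)).antisymm
    (range_subset_of_common_vertex hφ hφe hw hf hl' hI₂ he hl hI₁ (hj'.trans hc.symm))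

/-- For minimal `J`, Hall's theorem matches the edges with all the vertices. Following from each
vertex its matched edge to the other end gives a self-map of a finite set, and a periodic orbit,
traversed for its minimal period, is a cycle. -/
theorem exists_cycle_of_card_le [DecidableEq V] [Nonempty V] {G : Graph V β} (J : Finset β)
    (hJE : (J : Set β) ⊆ G.edgeSet) (hJ : J.Nonempty) (hcard : (J.biUnion G.ends).card ≤ J.card) :
    ∃ C, C ⊆ (J : Set β) ∧ G.IsCycleEdgeSet C := by
  classical
  induction J using Finset.strongInduction with
  | H J ih =>
    by_cases hmin : ∃ K ⊂ J, K.Nonempty ∧ (K.biUnion G.ends).card ≤ K.card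
    · obtain ⟨K, hKJ, hKn, hK⟩ := hmin
      have hKJ' : (K : Set β) ⊆ J := by exact_mod_cast hKJ.subset
      obtain ⟨C, hC, hC'⟩ := ih K hKJ (hKJ'.trans hJE) hKn hK
      exact ⟨C, hC.trans hKJ', hC'⟩
    push Not at hmin
    have hmono : ∀ K ⊆ J, (K.biUnion G.ends).card ≤ (J.biUnion G.ends).card := fun K hK ↦
      Finset.card_le_card (Finset.biUnion_subset_biUnion_of_subset_left _ hK)
    obtain ⟨φ, hφ, hφe⟩ : Matroid.HasSDR G.ends (J : Set β) := by
      rw [Matroid.hasSDR_iff]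
      intro K hK
      have hK' : K ⊆ J := by exact_mod_cast hK
      rcases Finset.eq_empty_or_nonempty K with rfl | hKn
      · simp
      by_cases hKJ : K = J
      · subst hKJ
        obtain ⟨e, he⟩ := hJ
        have hc := Finset.card_erase_add_one he
        rcases Finset.eq_empty_or_nonempty (K.erase e) with h0 | hn
        · rw [h0] at hc
          have h1 := (ends_nonempty (hJE he)).card_pos
          have h2 := Finset.card_le_card (Finset.subset_biUnion_of_mem G.ends he)
          simp at hc
          omega
        · have h1 := hmin _ (Finset.erase_ssubset he) hn
          have h2 := hmono _ (Finset.erase_subset e K)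
          omega
      · exact (hmin K (hK'.ssubset_of_ne hKJ) hKn).le
    have hsurj : ∀ x ∈ J.biUnion G.ends, ∃ e ∈ J, φ e = x := by
      intro x hx
      have himg : J.image φ = J.biUnion G.ends := by
        refine Finset.eq_of_subset_of_card_le ?_ ?_
        · intro y hy
          obtain ⟨e, he, rfl⟩ := Finset.mem_image.1 hy
          exact Finset.mem_biUnion.2 ⟨e, he, hφe e he⟩
        · rwa [Finset.card_image_of_injOn hφ]
      rw [← himg] at hx
      simpa using hx
    have hnext : ∀ x, ∃ (e : β) (y : V), x ∈ J.biUnion G.ends →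
        e ∈ J ∧ φ e = x ∧ G.IsLink e x y := by
      intro x
      by_cases hx : x ∈ J.biUnion G.ends
      · obtain ⟨e, he, hex⟩ := hsurj x hx
        have : G.Inc e x := by rw [← hex]; exact mem_ends.1 (hφe e he)
        obtain ⟨y, hy⟩ := this
        exact ⟨e, y, fun _ ↦ ⟨he, hex, hy⟩⟩
      · obtain ⟨e, -⟩ := hJ
        exact ⟨e, x, fun h ↦ absurd h hx⟩
    choose o next hon using hnext
    have hmap : ∀ x ∈ J.biUnion G.ends, next x ∈ J.biUnion G.ends := by
      intro x hx
      obtain ⟨h1, -, h3⟩ := hon x hx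
      exact Finset.mem_biUnion.2 ⟨_, h1, mem_ends.2 h3.inc_right⟩
    obtain ⟨x₀, hx₀⟩ : (J.biUnion G.ends).Nonempty := by
      obtain ⟨e, he⟩ := hJ
      obtain ⟨x, hx⟩ := ends_nonempty (hJE he)
      exact ⟨x, Finset.mem_biUnion.2 ⟨e, he, hx⟩⟩
    have hiter : ∀ x ∈ J.biUnion G.ends, ∀ k, next^[k] x ∈ J.biUnion G.ends := by
      intro x hx k
      induction k with
      | zero => exact hx
      | succ k ih => rw [Function.iterate_succ_apply']; exact hmap _ ih
    obtain ⟨y, hy, hyp⟩ : ∃ y ∈ J.biUnion G.ends, y ∈ Function.periodicPts next := by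
      obtain ⟨a, b, hab, heq⟩ := Finite.exists_ne_map_eq_of_infinite
        (fun k : ℕ ↦ (⟨next^[k] x₀, hiter x₀ hx₀ k⟩ : J.biUnion G.ends))
      have heq' : next^[a] x₀ = next^[b] x₀ := congrArg Subtype.val heq
      have key : ∀ a b, a < b → next^[a] x₀ = next^[b] x₀ →
          next^[a] x₀ ∈ Function.periodicPts next := by
        intro a b hab h
        refine Function.mk_mem_periodicPts (n := b - a) (by omega) ?_
        rw [Function.IsPeriodicPt, Function.IsFixedPt, ← Function.iterate_add_apply,
          Nat.sub_add_cancel hab.le, h]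
      rcases lt_or_gt_of_ne hab with h | h
      · exact ⟨_, hiter x₀ hx₀ a, key a b h heq'⟩
      · exact ⟨_, hiter x₀ hx₀ b, key b a h heq'.symm⟩
    obtain ⟨n, hn⟩ := Nat.exists_eq_succ_of_ne_zero
      (Function.minimalPeriod_pos_of_mem_periodicPts hyp).ne'
    have hvinj : Function.Injective (fun i : Fin (n + 1) ↦ next^[i.val] y) := by
      intro i j hij
      refine Fin.ext (Function.iterate_injOn_Iio_minimalPeriod (f := next) (x := y) ?_ ?_ hij)
      · rw [hn]; exact i.2
      · rw [hn]; exact j.2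
    have hmem := hiter y hy
    refine ⟨Set.range fun i : Fin (n + 1) ↦ o (next^[i.val] y), ?_, n, fun i ↦ next^[i.val] y,
      fun i ↦ o (next^[i.val] y), hvinj, ?_, ?_, rfl⟩
    · rintro _ ⟨i, rfl⟩
      exact (hon _ (hmem _)).1
    · intro i j hij
      refine hvinj ?_
      dsimp only at hij ⊢
      rw [← (hon _ (hmem i)).2.1, ← (hon _ (hmem j)).2.1, hij]
    · intro i
      have h1 := (hon _ (hmem i)).2.2
      have h2 : next^[(i + 1).val] y = next (next^[i.val] y) := by
        by_cases hi : i = Fin.last n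
        · rw [hi, Fin.last_add_one, ← Function.iterate_succ_apply' next, Fin.val_last,
            ← hn, Function.iterate_minimalPeriod]
          rfl
        · rw [Fin.val_add_one_of_lt (Fin.lt_last_iff_ne_last.2 hi),
            Function.iterate_succ_apply' next]
      dsimp only
      rw [h2]
      exact h1

/-- A minimal violator `J` of Hall's condition has more edges than vertices, so it contains a cycle,
and still contains one after an edge of that cycle is removed. Minimality makes `J` lie in one
component, which contradicts the uniqueness of the cycle. -/
theorem BicircularIndep.hasSDR [Nonempty V] {G : Graph V β} {I : Set β}
    (h : G.BicircularIndep I) : Matroid.HasSDR G.ends I := by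
  classical
  rw [Matroid.hasSDR_iff]
  intro J
  induction J using Finset.strongInduction with
  | H J ih =>
    intro hJI
    by_contra! hJ
    have hJE := hJI.trans h.1
    have hJn : J.Nonempty := by
      rw [Finset.nonempty_iff_ne_empty]
      rintro rfl
      simp at hJ
    obtain ⟨C, hCJ, hC⟩ := exists_cycle_of_card_le J hJE hJn hJ.le
    obtain ⟨e, heC⟩ : C.Nonempty := by
      obtain ⟨n, v, e, -, -, -, rfl⟩ := hC
      exact ⟨e 0, 0, rfl⟩
    have heJ : e ∈ J := hCJ heC
    have hsub : (J.erase e : Set β) ⊆ J := by simp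
    have hcard := Finset.card_erase_add_one heJ
    have hmono : ((J.erase e).biUnion G.ends).card ≤ (J.biUnion G.ends).card :=
      Finset.card_le_card (Finset.biUnion_subset_biUnion_of_subset_left _ (Finset.erase_subset _ _))
    have hen : (J.erase e).Nonempty := by
      rw [Finset.nonempty_iff_ne_empty]
      intro h0
      rw [h0] at hcard
      have h1 := (ends_nonempty (hJE heJ)).card_pos
      have h2 := Finset.card_le_card (Finset.subset_biUnion_of_mem G.ends heJ)
      simp at hcard
      omega
    obtain ⟨C', hC'J, hC'⟩ :=
      exists_cycle_of_card_le (J.erase e) (hsub.trans hJE) hen (by omega)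
    obtain ⟨e', he'C'⟩ : C'.Nonempty := by
      obtain ⟨n, v, e, -, -, -, rfl⟩ := hC'
      exact ⟨e 0, 0, rfl⟩
    obtain ⟨x, hx⟩ := ends_nonempty (hJE heJ)
    set K := J.filter fun f ↦ ∃ y, G.Inc f y ∧ G.JoinedIn I x y with hK
    -- `K` and `J \ K` have disjoint vertex sets; were both proper subsets, Hall's inequalities for
    -- them would add up to the one for `J`.
    have hKJ : K = J := by
      by_contra hne
      have heK : e ∈ K :=
        Finset.mem_filter.2 ⟨heJ, x, mem_ends.1 hx, Relation.ReflTransGen.refl⟩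
      have h1 := ih K ((Finset.filter_subset _ _).ssubset_of_ne hne)
        ((Finset.coe_subset.2 (Finset.filter_subset _ _)).trans hJI)
      have h2 := ih (J \ K) (Finset.sdiff_ssubset (Finset.filter_subset _ _) ⟨e, heK⟩)
        ((Finset.coe_subset.2 Finset.sdiff_subset).trans hJI)
      have hdisj : Disjoint (K.biUnion G.ends) ((J \ K).biUnion G.ends) := by
        rw [Finset.disjoint_left]
        intro y hy hy'
        obtain ⟨f, hf, hfy⟩ := Finset.mem_biUnion.1 hy
        obtain ⟨g, hg, hgy⟩ := Finset.mem_biUnion.1 hy'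
        rw [mem_ends] at hfy hgy
        obtain ⟨hfJ, z, hfz, hxz⟩ := Finset.mem_filter.1 hf
        obtain ⟨hgJ, hgK⟩ := Finset.mem_sdiff.1 hg
        refine hgK (Finset.mem_filter.2 ⟨hgJ, y, hgy, ?_⟩)
        obtain ⟨u, hu⟩ := hfz
        rcases hfy.eq_or_eq_of_isLink hu with rfl | rfl
        · exact hxz
        · exact hxz.tail ⟨f, hJI hfJ, hu⟩
      have h3 := Finset.card_union_of_disjoint hdisj
      rw [← Finset.union_biUnion, Finset.union_sdiff_of_subset (Finset.filter_subset _ _)] at h3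
      have h4 : (J \ K).card + K.card = J.card :=
        Finset.card_sdiff_add_card_eq_card (Finset.filter_subset _ _)
      omega
    have he'K : e' ∈ K := hKJ ▸ hsub (hC'J he'C')
    obtain ⟨-, y, hy, hxy⟩ := Finset.mem_filter.1 he'K
    have := h.2 C C' (hCJ.trans hJI) ((hC'J.trans hsub).trans hJI) hC hC'
      ⟨e, heC, e', he'C', x, y, mem_ends.1 hx, hy, hxy⟩
    have := hC'J (this ▸ heC)
    simp at this

theorem IsBicircularMatroid.isPresentedBy [Nonempty V] {G : Graph V β} {M : Matroid β}
    (h : G.IsBicircularMatroid M) : M.IsPresentedBy G.ends where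
  card_le := G.card_ends_le
  indep_iff I hI := by
    rw [h.2]
    exact ⟨fun h' ↦ h'.hasSDR, fun h' ↦ bicircularIndep_of_hasSDR (h.1 ▸ hI) h'⟩

end Graph

/-! ### Bicircular and cobicircular oriented matroids. -/

namespace SignedMatroid

variable {β : Type*}

/-- A cosimple minor of a bicircular matroid has a small flow in any lattice which
contains the restrictions of the signed circuits to the ground set of the minor. -/
theorem IsModOriented.exists_isSmallVector_of_isBicircularMatroid {V : Type*} {G : Graph V β}
    {O : SignedMatroid β} (hO : O.IsModOriented) (hG : G.IsBicircularMatroid O.toMatroid)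
    (A B : Set β) (hcos : (O.toMatroid.contract A |>.delete B).IsCosimple)
    (hne : (O.toMatroid.contract A |>.delete B).E.Nonempty) (L : AddSubgroup (β → ℤ))
    (hL : ∀ X ∈ O.circuits,
      (O.toMatroid.contract A |>.delete B).IsCircuit (Function.support (Aᶜ.indicator X)) →
      (fun e ↦ ((Aᶜ.indicator X e : SignType) : ℤ)) ∈ L) :
    ∃ x ∈ L, IsSmallVector x := by
  have hV : Nonempty V := by
    obtain ⟨e, he⟩ := hne
    have : e ∈ G.edgeSet := hG.1 ▸ he.1.1
    obtain ⟨x, -⟩ := Graph.ends_nonempty this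
    exact ⟨x⟩
  obtain ⟨ends, hends⟩ := hG.isPresentedBy.exists_contract hO.finite A
  rcases (hends.delete B).exists_loop_or_exchange
    (hO.finite.subset (Set.sdiff_subset.trans Set.sdiff_subset)) hcos hne with
    ⟨f, hf⟩ | ⟨D, f, g, hfg, hfD, hgD, hf, hg⟩
  · exact hO.exists_isSmallVector_of_isLoop A B hf L hL
  · exact hO.exists_isSmallVector_of_exchange A B hfg hfD hgD hf hg L hL

end SignedMatroid

theorem proposition4p7 {V β : Type*} (G : Graph V β) (O : SignedMatroid β) (hO : O.IsOriented) :
    (G.IsBicircularMatroid O.toMatroid → O.IsCoGSP) ∧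
    (G.IsBicircularMatroid O.toMatroid✶ → O.IsGSP) := by
  constructor
  · rintro hG _ ⟨A, B, rfl⟩ hcos hne
    refine hO.isModOriented.exists_isSmallVector_of_isBicircularMatroid hG A B hcos hne _
      fun X hX hc ↦ AddSubgroup.subset_closure ⟨Aᶜ.indicator X, ⟨⟨?_, X, hX, rfl⟩, ?_⟩, rfl⟩
    · exact hc.of_delete
    · exact (Matroid.delete_isCircuit_iff.1 hc).2
  · rintro hG _ ⟨A, B, rfl⟩ hsimple hne
    -- `A` and `B` may overlap. The common elements are contracted in the minor, so its dual deletes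
    -- them and contracts only `B \ A`.
    have hdual : ((O.toMatroid.contract A).delete B)✶ =
        (O.toMatroid✶.contract (B \ A)).delete A := by
      rw [Matroid.dual_contract_delete, Matroid.delete_contract_comm']
    refine hO.dual_isModOriented.exists_isSmallVector_of_isBicircularMatroid
      (O := O.dual) hG (B \ A) A ?_ ?_ _ fun Y hY hc ↦
        AddSubgroup.subset_closure ⟨(B \ A)ᶜ.indicator Y, ⟨?_, ?_⟩, rfl⟩
    · change Matroid.IsSimple (Matroid.dual ((O.toMatroid✶.contract (B \ A)).delete A))
      rw [← hdual, Matroid.dual_dual]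
      exact hsimple
    · change ((O.toMatroid✶.contract (B \ A)).delete A).E.Nonempty
      rw [← hdual]
      exact hne
    · change ((O.toMatroid.contract A).delete B)✶.IsCircuit _
      rw [hdual]
      exact hc
    · have hA := (Matroid.delete_isCircuit_iff.1 hc).2
      rintro _ ⟨⟨-, X, hX, rfl⟩, hXB⟩
      -- Restriction changes `X` only on `A`, where `Y` vanishes, and `Y` only on `B \ A`, where `X`
      -- vanishes. All products are unchanged, so orthogonality in `O` passes to the minor.
      have key : ∀ e, Aᶜ.indicator X e * (B \ A)ᶜ.indicator Y e = X e * Y e := by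
        intro e
        by_cases heA : e ∈ A
        · have h1 : (B \ A)ᶜ.indicator Y e = 0 := by
            by_contra hcon
            exact Set.disjoint_left.1 hA hcon heA
          have h2 : (B \ A)ᶜ.indicator Y e = Y e := by simp [heA]
          rw [h1, ← h2, h1, mul_zero, mul_zero]
        · have h2 : Aᶜ.indicator X e = X e := by simp [heA]
          by_cases heB : e ∈ B
          · have h1 : Aᶜ.indicator X e = 0 := by
              by_contra hcon
              exact Set.disjoint_left.1 hXB hcon heB
            rw [h1, ← h2, h1, zero_mul, zero_mul]
          · rw [h2]
            simp [heB]
      have := hY.2 X hX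
      simp only [SignedMatroid.Orthogonal, key]
      exact this
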